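/- Let $q$ be an odd prime power and let $\mathbb{F}_q[T]$ be the ring of polynomials over the finite field with $q$ elements. For $n\ge 0$ let $B_q(n)$ be the number of monic polynomials $f\in\mathbb{F}_q[T]$ of degree $n$ that can be written as $f=A^2+TB^2$ with $A,B\in\mathbb{F}_q[T]$. For a nonzero polynomial $P$ put $|P|=q^{\deg P}$, and for a monic irreducible polynomial $P$ and $f\in\mathbb{F}_q[T]$ let the Legendre symbol $\left(\frac{f}{P}\right)\in\{0,1,-1\}$ be determined by $\left(\frac{f}{P}\right)\equiv f^{(|P|-1)/2}\pmod P$. Then the product over all monic irreducible polynomials $P$ with $\left(\frac{P}{T}\right)=-1$ in $$K_q=\left(1-q^{-1}\right)^{-1/2}\prod_{\left(\frac{P}{T}\right)=-1}\left(1-|P|^{-2}\right)^{-1/2}$$ converges (unconditionally), and for fixed $q$, as $n\to\infty$, $$B_q(n)=\frac{K_q}{\sqrt{\pi}}\cdot\frac{q^n}{\sqrt{n}}+O_q\!\left(\frac{q^n}{n^{3/2}}\right),$$ where the implied constant depends only on $q$. -/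

import Mathlib

open Polynomial Filter Asymptotics

noncomputable section

namespace FunctionFieldLandau

variable {F : Type*} [Field F] [Fintype F]

/-- The set of monic polynomials of degree `n` over the finite field `F`. -/
def monicOfDegree (F : Type*) [Field F] (n : ℕ) : Set F[X] :=
  {f | f.Monic ∧ f.natDegree = n}

/-- `f = A² + T B²` for some polynomials `A`, `B`, where `T` is the variable. -/
def IsNormForm (f : F[X]) : Prop :=
  ∃ A B : F[X], f = A ^ 2 + X * B ^ 2

/-- There are only finitely many monic polynomials of a given degree, so that the cardinality
`normCount` below is a true count. -/
theorem finite_monicOfDegree (F : Type*) [Field F] [Fintype F] (n : ℕ) :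
    (monicOfDegree F n).Finite := by
  have : Finite (degreeLT F (n + 1)) := Finite.of_equiv _ (degreeLTEquiv F (n + 1)).toEquiv.symm
  refine Set.Finite.subset (Set.toFinite ((degreeLT F (n + 1) : Submodule F F[X]) : Set F[X])) ?_
  rintro f ⟨hm, hn⟩
  rw [SetLike.mem_coe, mem_degreeLT, degree_eq_natDegree hm.ne_zero, hn]
  exact_mod_cast Nat.lt_succ_self n

/-- `B_q(n)`: the number of monic polynomials of degree `n` of the form `A² + T B²`. -/
def normCount (F : Type*) [Field F] [Fintype F] (n : ℕ) : ℕ :=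
  {f ∈ monicOfDegree F n | IsNormForm f}.ncard

/-- The absolute value `|f| = q ^ deg f` of a nonzero polynomial, `q` being the size of `F`. -/
def absValue (f : F[X]) : ℕ :=
  Fintype.card F ^ f.natDegree

open Classical in
/-- The Legendre symbol `(f / P)`: the element of `{1, -1, 0}` that is congruent to
`f ^ ((|P| - 1) / 2)` modulo `P` (for `P` monic irreducible and `q` odd). -/
def legendre (f P : F[X]) : ℤ :=
  if P ∣ f ^ ((absValue P - 1) / 2) - 1 then 1
  else if P ∣ f ^ ((absValue P - 1) / 2) + 1 then -1
  else 0

/-- The monic irreducible polynomials `P` with `(P / T) = -1`. -/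
def InertPrime (F : Type*) [Field F] [Fintype F] : Type _ :=
  {P : F[X] // P.Monic ∧ Irreducible P ∧ legendre P X = -1}

/-- The factor `(1 - |P|⁻²) ^ (-1/2)` of the product defining `K_q`. -/
def eulerFactor (P : InertPrime F) : ℝ :=
  (1 - ((absValue P.1 : ℝ) ^ 2)⁻¹) ^ (-(1 / 2) : ℝ)

/-- `K_q = (1 - q⁻¹) ^ (-1/2) * ∏_{(P / T) = -1} (1 - |P|⁻²) ^ (-1/2)`. -/
def landauConst (F : Type*) [Field F] [Fintype F] : ℝ :=
  (1 - (Fintype.card F : ℝ)⁻¹) ^ (-(1 / 2) : ℝ) * ∏' P : InertPrime F, eulerFactor P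

end FunctionFieldLandau

end

/-!
Let `D(u) = ∑ B(n) uⁿ` be the generating function of the norm forms, and let `χ` be the quadratic
character of the constant coefficient, so that `χ(P) = (P / T)` for a monic irreducible `P`.

*Arithmetic.* A monic polynomial is of the form `A² + T B²` if and only if every inert prime
(`χ(P) = -1`) occurs in it to an even power (`isNormForm_primeProd_iff`). The norm of `-T mod P`
from `F[T] / P` to `F` is `P(0)`, so `-T` is a square modulo `P ≠ T` if and only if `χ(P) = 1`
(`isSquare_neg_root_iff`). If it is, Thue's lemma represents `P` itself (`isNormForm_of_dvd`). If it
is not, `P ∣ A² + T B²` forces `P ∣ A` and `P ∣ B`, and one descends.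

*Generating functions.* Monic polynomials are exponent vectors over the monic irreducibles, and a
function on them is a multivariate power series, whose product is Dirichlet convolution. For
multiplicative functions the convolution is computed locally (`mulSeries_mul`), and passing to the
generating function by degree is multiplicative (`weightSeries_mul`). Comparing local factors
(`normFactor_mul_self`) gives
`D(u)² = (1 - u)⁻¹ · ζ(u) · L(u, χ) · ∏ (1 - u ^ (2 deg P))⁻¹`, the product being over the inert
primes. Here `ζ(u) = (1 - q u)⁻¹`, and `L(u, χ) = 1` because `χ` sums to `0` over the monic
polynomials of any positive degree. Hence `D(u) = G(u) (1 - q u) ^ (-1/2)` with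
`G(u) = (1 - u) ^ (-1/2) ∏ (1 - u ^ (2 deg P)) ^ (-1/2)` (`mk_normCount_eq`).

*Asymptotics.* The product in `G` is supported on squares, so the coefficients `a_k` of `G` are
`O((k + 1) q ^ (k / 2))` (`analyticCoeff_le`), and `G(1 / q) = K_q` by an Euler product over nonnegative
terms (`hasProd_eulerFactor`). With `c_m = binom(2m, m) / 4 ^ m` the coefficients of
`(1 - x) ^ (-1/2)`, one has `B(n) / qⁿ = ∑ a_k q ^ (-k) c_{n - k}`. Wallis' product gives
`c_{n - k} = 1 / √(π n) + O((k + 1)² / n ^ (3 / 2))` uniformly in `k` (`abs_invSqrtCoeff_sub_le`),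
and the theorem follows by summing over `k`.
-/

open Finset.HasAntidiagonal (antidiagonal mem_antidiagonal)

namespace FunctionFieldLandau

/-! ### The coefficients of `(1 - x) ^ (-1/2)` -/

/-- The Taylor coefficient `binom(2k, k) / 4 ^ k` of `(1 - x) ^ (-1/2)`. -/
noncomputable def invSqrtCoeff (k : ℕ) : ℝ := (Nat.centralBinom k : ℝ) / 4 ^ k

theorem invSqrtCoeff_zero : invSqrtCoeff 0 = 1 := by simp [invSqrtCoeff]

theorem invSqrtCoeff_nonneg (k : ℕ) : 0 ≤ invSqrtCoeff k := by
  unfold invSqrtCoeff; positivity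

theorem invSqrtCoeff_le_one (k : ℕ) : invSqrtCoeff k ≤ 1 := by
  unfold invSqrtCoeff
  rw [div_le_one (by positivity)]
  exact_mod_cast Nat.centralBinom_le_four_pow k

theorem invSqrtCoeff_succ (k : ℕ) :
    2 * ((k : ℝ) + 1) * invSqrtCoeff (k + 1) = (2 * k + 1) * invSqrtCoeff k := by
  have h : ((k : ℝ) + 1) * (Nat.centralBinom (k + 1) : ℝ)
      = 2 * (2 * k + 1) * (Nat.centralBinom k : ℝ) := by
    exact_mod_cast Nat.succ_mul_centralBinom_succ k
  unfold invSqrtCoeff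
  rw [pow_succ]
  field_simp
  linarith

/-- The formal power series of `(1 - x) ^ (-1/2)`. -/
noncomputable def invSqrtSeries : PowerSeries ℝ := PowerSeries.mk invSqrtCoeff

/-- Differentiating, `2 (1 - X) C' = C` for `C = invSqrtSeries`, so `(1 - X) C²` is constant. -/
theorem one_sub_X_mul_invSqrtSeries_sq :
    (1 - PowerSeries.X) * invSqrtSeries ^ 2 = 1 := by
  have hode : 2 * ((1 - PowerSeries.X) * PowerSeries.derivative ℝ invSqrtSeries)
      = invSqrtSeries := by
    ext n
    rw [two_mul, map_add, sub_mul, one_mul, map_sub]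
    cases n with
    | zero =>
      have := invSqrtCoeff_succ 0
      simp [invSqrtSeries, PowerSeries.coeff_derivative] at this ⊢
      linarith
    | succ n =>
      have := invSqrtCoeff_succ (n + 1)
      rw [PowerSeries.coeff_succ_X_mul]
      simp [invSqrtSeries, PowerSeries.coeff_derivative] at this ⊢
      linarith
  refine PowerSeries.derivative.ext (R := ℝ) ?_ ?_
  · have : PowerSeries.derivative ℝ ((1 - PowerSeries.X) * invSqrtSeries ^ 2)
        = invSqrtSeries * (2 * ((1 - PowerSeries.X) * PowerSeries.derivative ℝ invSqrtSeries)
            - invSqrtSeries) := by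
      simp only [Derivation.leibniz, Derivation.leibniz_pow, map_sub, PowerSeries.derivative_X,
        smul_eq_mul, nsmul_eq_mul, Derivation.map_one_eq_zero]
      push_cast
      ring
    rw [this, hode]
    simp
  · simp [invSqrtSeries, invSqrtCoeff_zero]

theorem mk_one_mul_one_sub_X :
    (PowerSeries.mk fun _ ↦ (1 : ℝ)) * (1 - PowerSeries.X) = 1 :=
  PowerSeries.mk_one_mul_one_sub_eq_one ℝ

theorem invSqrtSeries_sq : invSqrtSeries ^ 2 = PowerSeries.mk fun _ ↦ (1 : ℝ) := by
  calc invSqrtSeries ^ 2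
      = ((PowerSeries.mk fun _ ↦ (1 : ℝ)) * (1 - PowerSeries.X)) * invSqrtSeries ^ 2 := by
        rw [mk_one_mul_one_sub_X, one_mul]
    _ = _ := by rw [mul_assoc, one_sub_X_mul_invSqrtSeries_sq, mul_one]

theorem sum_antidiagonal_invSqrtCoeff (n : ℕ) :
    ∑ p ∈ antidiagonal n, invSqrtCoeff p.1 * invSqrtCoeff p.2 = 1 := by
  have h := congrArg (PowerSeries.coeff n) invSqrtSeries_sq
  simpa [sq, PowerSeries.coeff_mul, invSqrtSeries] using h

theorem summable_invSqrtCoeff_mul_pow {x : ℝ} (h0 : 0 ≤ x) (h1 : x < 1) :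
    Summable fun k ↦ invSqrtCoeff k * x ^ k := by
  refine (summable_geometric_of_lt_one h0 h1).of_nonneg_of_le (fun k ↦ ?_) fun k ↦ ?_
  · exact mul_nonneg (invSqrtCoeff_nonneg k) (by positivity)
  · exact mul_le_of_le_one_left (by positivity) (invSqrtCoeff_le_one k)

theorem tsum_invSqrtCoeff_mul_pow {x : ℝ} (h0 : 0 ≤ x) (h1 : x < 1) :
    ∑' k, invSqrtCoeff k * x ^ k = (1 - x) ^ (-(1 / 2) : ℝ) := by
  have hs := summable_invSqrtCoeff_mul_pow h0 h1
  have hn : Summable fun k ↦ ‖invSqrtCoeff k * x ^ k‖ := hs.norm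
  have hsq : (∑' k, invSqrtCoeff k * x ^ k) * (∑' k, invSqrtCoeff k * x ^ k) = (1 - x)⁻¹ := by
    rw [tsum_mul_tsum_eq_tsum_sum_antidiagonal_of_summable_norm hn hn,
      ← tsum_geometric_of_lt_one h0 h1]
    refine tsum_congr fun n ↦ ?_
    rw [← one_mul (x ^ n), ← sum_antidiagonal_invSqrtCoeff n, Finset.sum_mul]
    refine Finset.sum_congr rfl fun p hp ↦ ?_
    rw [← mem_antidiagonal.1 hp, pow_add]
    ring
  have hnn : 0 ≤ ∑' k, invSqrtCoeff k * x ^ k :=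
    tsum_nonneg fun k ↦ mul_nonneg (invSqrtCoeff_nonneg k) (by positivity)
  rw [Real.rpow_neg (by linarith), ← Real.sqrt_eq_rpow, ← Real.sqrt_inv, ← hsq,
    Real.sqrt_mul_self hnn]

/-- Wallis' product is `1 / ((2m + 1) c_m²)` for the coefficients `c_m` of `(1 - x) ^ (-1/2)`. -/
theorem wallis_mul_invSqrtCoeff_sq (m : ℕ) :
    Real.Wallis.W m * ((2 * m + 1) * invSqrtCoeff m ^ 2) = 1 := by
  induction m with
  | zero => simp [Real.Wallis.W, invSqrtCoeff_zero]
  | succ m ih =>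
    have h := invSqrtCoeff_succ m
    have h' : invSqrtCoeff (m + 1) = (2 * m + 1) * invSqrtCoeff m / (2 * (m + 1)) := by
      rw [← h]; field_simp
    rw [Real.Wallis.W_succ, h']
    push_cast
    refine Eq.trans ?_ ih
    field_simp
    ring

theorem invSqrtCoeff_sq_ge (m : ℕ) : 1 / (Real.pi * (m + 1 / 2)) ≤ invSqrtCoeff m ^ 2 := by
  have h := wallis_mul_invSqrtCoeff_sq m
  have hW := Real.Wallis.W_le m
  have hpi := Real.pi_pos
  rw [div_le_iff₀ (by positivity)]
  nlinarith [mul_le_mul_of_nonneg_right hW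
    (show 0 ≤ (2 * (m : ℝ) + 1) * invSqrtCoeff m ^ 2 by positivity)]

theorem invSqrtCoeff_sq_le (m : ℕ) :
    invSqrtCoeff m ^ 2 ≤ (m + 1) / (Real.pi * (m + 1 / 2) ^ 2) := by
  have h := wallis_mul_invSqrtCoeff_sq m
  have hW := Real.Wallis.le_W m
  have hpi := Real.pi_pos
  have h2 := mul_le_mul_of_nonneg_right hW
    (show 0 ≤ (2 * (m : ℝ) + 1) * invSqrtCoeff m ^ 2 by positivity)
  rw [h] at h2
  rw [le_div_iff₀ (by positivity)]
  have h3 : (2 * (m : ℝ) + 1) / (2 * m + 2) * (Real.pi / 2) * ((2 * m + 1) * invSqrtCoeff m ^ 2)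
      = (invSqrtCoeff m ^ 2 * (Real.pi * (m + 1 / 2) ^ 2)) / (m + 1) := by
    field_simp
  rw [h3, div_le_one (by positivity)] at h2
  exact h2

/-- The comparison of `c_{n-k}` with `1 / √(π n)`, with a loss polynomial in `k` that makes it
valid for all `k`, also beyond `n`. -/
theorem abs_invSqrtCoeff_sub_le (n k : ℕ) (hn : 0 < n) :
    |(if k ≤ n then invSqrtCoeff (n - k) else 0) - 1 / √(Real.pi * n)|
      ≤ 4 / √Real.pi * ((k + 1) ^ 2 / (n : ℝ) ^ (3 / 2 : ℝ)) := by
  set x : ℝ := if k ≤ n then invSqrtCoeff (n - k) else 0 with hx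
  have hx0 : 0 ≤ x := by
    rw [hx]; split_ifs
    exacts [invSqrtCoeff_nonneg _, le_rfl]
  have hn' : (0 : ℝ) < n := by exact_mod_cast hn
  have hn1 : (1 : ℝ) ≤ n := by exact_mod_cast hn
  have hpi := Real.pi_pos
  have hpi3 := Real.pi_gt_three
  have hk0 : (0 : ℝ) ≤ k := Nat.cast_nonneg k
  -- Wallis' product controls squares; the bound on `x - s` then follows on dividing by `x + s ≥ s`.
  have key : |x ^ 2 - 1 / (Real.pi * n)| ≤ 4 * ((k + 1) ^ 2 / (n : ℝ) ^ 2) / Real.pi := by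
    rw [le_div_iff₀ hpi, ← abs_of_pos hpi, ← abs_mul, abs_of_pos hpi, sub_mul]
    have e1 : 1 / (Real.pi * n) * Real.pi = 1 / n := by field_simp
    rw [e1, abs_le]
    rcases le_or_gt k n with h | h
    · obtain ⟨m, rfl⟩ := Nat.exists_eq_add_of_le h
      have hxm : x = invSqrtCoeff m := by simp [hx]
      have hm0 : (0 : ℝ) ≤ m := Nat.cast_nonneg m
      have l1 := invSqrtCoeff_sq_ge m
      have l2 := invSqrtCoeff_sq_le m
      rw [div_le_iff₀ (by positivity)] at l1
      rw [le_div_iff₀ (by positivity)] at l2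
      rw [hxm]
      push_cast at hn' hn1 ⊢
      set y := invSqrtCoeff m ^ 2 * Real.pi with hy
      have l1' : 1 ≤ y * (m + 1 / 2) := by rw [hy]; linarith
      have l2' : y * (m + 1 / 2) ^ 2 ≤ m + 1 := by rw [hy]; linarith
      have hmk : (k : ℝ) + m ≤ (k + 1) * (m + 1) := by nlinarith
      have hmh : (m : ℝ) + 1 ≤ 2 * (m + 1 / 2) := by linarith
      constructor
      · have : (1 : ℝ) / (m + 1 / 2) ≤ y := by rw [div_le_iff₀ (by positivity)]; linarith
        have : 1 / ((k : ℝ) + m) ≤ 1 / (m + 1 / 2) + 4 * ((k + 1) ^ 2 / (k + m) ^ 2) := by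
          have e : 1 / ((k : ℝ) + m) - 1 / (m + 1 / 2)
              = (1 / 2 - k) / ((k + m) * (m + 1 / 2)) := by field_simp; ring
          have : (1 / 2 - (k : ℝ)) / ((k + m) * (m + 1 / 2)) ≤ 4 * ((k + 1) ^ 2 / (k + m) ^ 2) := by
            rw [← mul_div_assoc, div_le_div_iff₀ (by positivity) (by positivity)]
            have : (1 / 2 - (k : ℝ)) * (k + m) ≤ 4 * (k + 1) ^ 2 * (m + 1 / 2) := by
              nlinarith [mul_nonneg hk0 hm0, mul_nonneg (mul_nonneg hk0 hk0) hm0]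
            nlinarith [mul_le_mul_of_nonneg_right this hn'.le]
          linarith
        linarith
      · have : y ≤ (m + 1) / (m + 1 / 2) ^ 2 := by rw [le_div_iff₀ (by positivity)]; exact l2'
        have : ((m : ℝ) + 1) / (m + 1 / 2) ^ 2
            ≤ 1 / (k + m) + 4 * ((k + 1) ^ 2 / (k + m) ^ 2) := by
          have e : ((m : ℝ) + 1) / (m + 1 / 2) ^ 2 - 1 / (k + m)
              = (m * k + k - 1 / 4) / ((m + 1 / 2) ^ 2 * (k + m)) := by field_simp; ring
          have : ((m : ℝ) * k + k - 1 / 4) / ((m + 1 / 2) ^ 2 * (k + m))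
              ≤ 4 * ((k + 1) ^ 2 / (k + m) ^ 2) := by
            rw [← mul_div_assoc, div_le_div_iff₀ (by positivity) (by positivity)]
            have : ((m : ℝ) * k + k - 1 / 4) * (k + m) ≤ 4 * (k + 1) ^ 2 * (m + 1 / 2) ^ 2 := by
              nlinarith [mul_nonneg hk0 hm0, mul_nonneg (mul_nonneg hk0 hk0) hm0,
                mul_nonneg (mul_nonneg hk0 hm0) hm0, mul_self_nonneg ((k : ℝ) * m)]
            nlinarith [mul_le_mul_of_nonneg_right this hn'.le]
          linarith
        linarith
    · have hx' : x = 0 := by simp [hx, not_le.2 h]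
      have hkn : (n : ℝ) ≤ k := by exact_mod_cast h.le
      have : 1 / (n : ℝ) ≤ 4 * ((k + 1) ^ 2 / (n : ℝ) ^ 2) := by
        rw [← mul_div_assoc, div_le_div_iff₀ hn' (by positivity)]
        nlinarith
      have h4 : 0 ≤ 1 / (n : ℝ) := by positivity
      rw [hx']
      constructor <;> nlinarith
  set s : ℝ := 1 / √(Real.pi * n) with hs
  have hspos : 0 < s := by positivity
  have hs2 : s ^ 2 = 1 / (Real.pi * n) := by
    rw [hs, div_pow, Real.sq_sqrt (by positivity), one_pow]
  rw [← hs2] at key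
  have h1 : |x - s| * s ≤ |x ^ 2 - s ^ 2| := by
    rw [show x ^ 2 - s ^ 2 = (x - s) * (x + s) by ring, abs_mul,
      abs_of_pos (by linarith : 0 < x + s)]
    exact mul_le_mul_of_nonneg_left (by linarith) (abs_nonneg _)
  have h2 : |x - s| ≤ 4 * ((k + 1) ^ 2 / (n : ℝ) ^ 2) / Real.pi / s := by
    rw [le_div_iff₀ hspos]; exact h1.trans key
  refine h2.trans (le_of_eq ?_)
  have hr : (n : ℝ) ^ (3 / 2 : ℝ) = n * √n := by
    rw [show (3 / 2 : ℝ) = 1 + 1 / 2 by norm_num, Real.rpow_add hn', Real.rpow_one,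
      Real.sqrt_eq_rpow]
  rw [hr, hs, Real.sqrt_mul hpi.le]
  have a1 : √Real.pi ^ 2 = Real.pi := Real.sq_sqrt hpi.le
  have a2 : √(n : ℝ) ^ 2 = n := Real.sq_sqrt hn'.le
  field_simp
  rw [a1, a2]
  ring

/-! ### Multiplicative functions as multivariate power series -/

section Multiplicative

variable {σ : Type*}

/-- The multiplicative function on the free commutative monoid `σ →₀ ℕ` whose value at `k • P` is
the `k`-th coefficient of the local factor `f P` (meant to have constant coefficient `1`), as a
multivariate power series. Multiplication of such series is Dirichlet convolution. -/
noncomputable def mulSeries (f : σ → PowerSeries ℝ) : MvPowerSeries σ ℝ :=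
  fun d ↦ d.prod fun P k ↦ PowerSeries.coeff k (f P)

theorem coeff_mulSeries (f : σ → PowerSeries ℝ) (d : σ →₀ ℕ) :
    MvPowerSeries.coeff d (mulSeries f) = d.prod fun P k ↦ PowerSeries.coeff k (f P) := rfl

/-- The convolution of multiplicative functions is computed one local factor at a time. -/
theorem mulSeries_mul {f g : σ → PowerSeries ℝ} (hf : ∀ P, PowerSeries.constantCoeff (f P) = 1)
    (hg : ∀ P, PowerSeries.constantCoeff (g P) = 1) :
    mulSeries (f * g) = mulSeries f * mulSeries g := by
  classical
  symm
  ext d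
  simp_rw [coeff_mulSeries, MvPowerSeries.coeff_mul, Pi.mul_apply, PowerSeries.coeff_mul]
  rw [Finsupp.prod, Finset.prod_sum]
  have hsub : ∀ p ∈ antidiagonal d, p.1.support ⊆ d.support ∧ p.2.support ⊆ d.support := by
    intro p hp
    rw [mem_antidiagonal] at hp
    have h1 : p.1 ≤ d := hp ▸ le_self_add
    have h2 : p.2 ≤ d := hp ▸ le_add_self
    exact ⟨Finsupp.support_mono h1, Finsupp.support_mono h2⟩
  refine Finset.sum_bij' (fun p _ ↦ fun P _ ↦ (p.1 P, p.2 P))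
    (fun φ _ ↦ (Finsupp.onFinset d.support (fun P ↦ if h : P ∈ d.support then (φ P h).1 else 0)
        (fun P h ↦ by by_contra h'; simp [h'] at h),
      Finsupp.onFinset d.support (fun P ↦ if h : P ∈ d.support then (φ P h).2 else 0)
        (fun P h ↦ by by_contra h'; simp [h'] at h))) ?_ ?_ ?_ ?_ ?_
  · intro p hp
    rw [mem_antidiagonal] at hp
    simp only [Finset.mem_pi, mem_antidiagonal]
    intro P _
    rw [← hp, Finsupp.add_apply]
  · intro φ hφ
    simp only [Finset.mem_pi, mem_antidiagonal] at hφ ⊢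
    ext P
    simp only [Finsupp.add_apply, Finsupp.onFinset_apply]
    split_ifs with h
    · exact hφ P h
    · simpa [eq_comm] using h
  · intro p hp
    obtain ⟨h1, h2⟩ := hsub p hp
    ext P
    · simp only [Finsupp.onFinset_apply]
      split_ifs with h
      · rfl
      · exact (Finsupp.notMem_support_iff.1 fun h' ↦ h (h1 h')).symm
    · simp only [Finsupp.onFinset_apply]
      split_ifs with h
      · rfl
      · exact (Finsupp.notMem_support_iff.1 fun h' ↦ h (h2 h')).symm
  · intro φ hφ
    funext P h
    simp only [Finsupp.onFinset_apply, h, dif_pos]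
  · intro p hp
    obtain ⟨h1, h2⟩ := hsub p hp
    rw [coeff_mulSeries, coeff_mulSeries,
      Finsupp.prod_of_support_subset _ h1 _ fun P _ ↦ by simpa using hf P,
      Finsupp.prod_of_support_subset _ h2 _ fun P _ ↦ by simpa using hg P,
      ← Finset.prod_mul_distrib]
    exact (Finset.prod_attach d.support fun P ↦
      PowerSeries.coeff (p.1 P) (f P) * PowerSeries.coeff (p.2 P) (g P)).symm

/-- The generating function, by weight, of a function on `σ →₀ ℕ`: the weight-`n` coefficient is
the sum of the values at the finitely many exponent vectors of weight `n`. -/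
noncomputable def weightSeries (w : σ → ℕ) (hw : ∀ n, {d : σ →₀ ℕ | Finsupp.weight w d = n}.Finite)
    (f : MvPowerSeries σ ℝ) : PowerSeries ℝ :=
  PowerSeries.mk fun n ↦ ∑ d ∈ (hw n).toFinset, MvPowerSeries.coeff d f

variable {w : σ → ℕ} {hw : ∀ n, {d : σ →₀ ℕ | Finsupp.weight w d = n}.Finite}

theorem coeff_weightSeries (f : MvPowerSeries σ ℝ) (n : ℕ) :
    PowerSeries.coeff n (weightSeries w hw f) = ∑ d ∈ (hw n).toFinset, MvPowerSeries.coeff d f := by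
  simp [weightSeries]

theorem weightSeries_mul (f g : MvPowerSeries σ ℝ) :
    weightSeries w hw (f * g) = weightSeries w hw f * weightSeries w hw g := by
  classical
  ext n
  rw [PowerSeries.coeff_mul, coeff_weightSeries]
  simp_rw [coeff_weightSeries, Finset.sum_mul_sum, ← Finset.sum_product',
    MvPowerSeries.coeff_mul]
  rw [Finset.sum_sigma', Finset.sum_sigma']
  refine Finset.sum_bij' (fun x _ ↦ ⟨(Finsupp.weight w x.2.1, Finsupp.weight w x.2.2), x.2⟩)
    (fun y _ ↦ ⟨y.2.1 + y.2.2, y.2⟩) ?_ ?_ ?_ ?_ ?_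
  · rintro ⟨d, a, b⟩ h
    simp only [Finset.mem_sigma, Set.Finite.mem_toFinset, Set.mem_ofPred_eq,
      mem_antidiagonal] at h
    simp [← h.1, ← h.2]
  · rintro ⟨⟨i, j⟩, a, b⟩ h
    simp only [Finset.mem_sigma, Set.Finite.mem_toFinset, Set.mem_ofPred_eq,
      mem_antidiagonal, Finset.mem_product] at h
    simp [h.2.1, h.2.2, h.1]
  · rintro ⟨d, a, b⟩ h
    simp only [Finset.mem_sigma, mem_antidiagonal] at h
    simp [h.2]
  · rintro ⟨⟨i, j⟩, a, b⟩ h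
    simp only [Finset.mem_sigma, Set.Finite.mem_toFinset, Set.mem_ofPred_eq,
      Finset.mem_product] at h
    simp [h.2.1, h.2.2]
  · intros; rfl

end Multiplicative

/-! ### Euler products over free commutative monoids -/

section EulerProduct

variable {σ : Type*}

/-- Splitting off one coordinate of the exponent vectors supported in `insert P S`. -/
noncomputable def supportInsertEquiv [DecidableEq σ] {P : σ} {S : Finset σ} (hP : P ∉ S) :
    ℕ × {d : σ →₀ ℕ // d.support ⊆ S} ≃ {d : σ →₀ ℕ // d.support ⊆ insert P S} where
  toFun x := ⟨Finsupp.single P x.1 + x.2.1, fun Q hQ ↦ by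
    have := Finsupp.support_add hQ
    rw [Finset.mem_union] at this
    rcases this with h | h
    · have := Finsupp.support_single_subset h
      simp at this
      simp [this]
    · exact Finset.mem_insert_of_mem (x.2.2 h)⟩
  invFun d := (d.1 P, ⟨d.1.erase P, fun Q hQ ↦ by
    rw [Finsupp.support_erase, Finset.mem_erase] at hQ
    exact Finset.mem_of_mem_insert_of_ne (d.2 hQ.2) hQ.1⟩)
  left_inv x := by
    have h0 : x.2.1 P = 0 := Finsupp.notMem_support_iff.1 fun h ↦ hP (x.2.2 h)
    ext Q
    · simp [h0]
    · by_cases hQ : Q = P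
      · subst hQ; simp [h0]
      · simp [Finsupp.erase_ne hQ]
  right_inv d := by
    ext Q
    simp [Finsupp.single_add_erase]

theorem hasSum_prod_support_subset {a : σ → ℕ → ℝ} (h1 : ∀ P, a P 0 = 1)
    (h0 : ∀ P k, 0 ≤ a P k) (hs : ∀ P, Summable (a P)) (S : Finset σ) :
    HasSum (fun d : {d : σ →₀ ℕ // d.support ⊆ S} ↦ d.1.prod a) (∏ P ∈ S, ∑' k, a P k) := by
  classical
  induction S using Finset.induction_on with
  | empty =>
    rw [Finset.prod_empty]
    have hz (d : {d : σ →₀ ℕ // d.support ⊆ ∅}) : d = ⟨0, by simp⟩ :=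
      Subtype.ext (Finsupp.support_eq_empty.1 (Finset.subset_empty.1 d.2))
    convert hasSum_single (⟨0, Finset.empty_subset ∅⟩ : {d : σ →₀ ℕ // d.support ⊆ ∅})
      (f := fun d ↦ d.1.prod a) fun d hd ↦ absurd (hz d) hd
    simp
  | insert P S hP ih =>
    rw [Finset.prod_insert hP, ← (supportInsertEquiv hP).hasSum_iff]
    have hnn : ∀ d : σ →₀ ℕ, 0 ≤ d.prod a := fun d ↦ Finset.prod_nonneg fun Q _ ↦ h0 Q _
    have hsum := (hs P).mul_of_nonneg ih.summable (h0 P) fun d ↦ hnn d.1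
    refine HasSum.congr_fun ((hs P).hasSum.mul ih hsum) fun x ↦ ?_
    have hx : Disjoint (Finsupp.single P x.1).support x.2.1.support :=
      (Finset.disjoint_singleton_left.2 fun h ↦ hP (x.2.2 h)).mono_left
        Finsupp.support_single_subset
    change (Finsupp.single P x.1 + x.2.1).prod a = _
    rw [Finsupp.prod_add_index_of_disjoint hx, Finsupp.prod_single_index (h1 P)]

/-- The Euler product over a free commutative monoid, for nonnegative local factors. -/
theorem hasProd_tsum_of_summable_prod {a : σ → ℕ → ℝ} (h1 : ∀ P, a P 0 = 1)
    (h0 : ∀ P k, 0 ≤ a P k) (hs : ∀ P, Summable (a P))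
    (hsum : Summable fun d : σ →₀ ℕ ↦ d.prod a) :
    HasProd (fun P ↦ ∑' k, a P k) (∑' d : σ →₀ ℕ, d.prod a) := by
  classical
  have hnn : ∀ d : σ →₀ ℕ, 0 ≤ d.prod a := fun d ↦ Finset.prod_nonneg fun Q _ ↦ h0 Q _
  have heq : ∀ S : Finset σ, ∏ P ∈ S, ∑' k, a P k =
      ∑' d : σ →₀ ℕ, {d : σ →₀ ℕ | d.support ⊆ S}.indicator (fun d ↦ d.prod a) d := fun S ↦ by
    rw [← (hasSum_prod_support_subset h1 h0 hs S).tsum_eq]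
    exact tsum_subtype {d : σ →₀ ℕ | d.support ⊆ S} (fun d ↦ d.prod a)
  -- The partial product over `S` is the sum over the exponent vectors supported in `S`.
  rw [HasProd, SummationFilter.unconditional_filter]
  simp_rw [heq]
  refine tendsto_tsum_of_dominated_convergence hsum (fun d ↦ ?_) (Eventually.of_forall fun S d ↦ ?_)
  · refine tendsto_const_nhds.congr' ?_
    filter_upwards [eventually_ge_atTop d.support] with S hS
    rw [Set.indicator_of_mem]
    exact hS
  · rw [Real.norm_eq_abs, abs_of_nonneg (Set.indicator_nonneg (fun d _ ↦ hnn d) d)]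
    exact Set.indicator_le_self' (fun d _ ↦ hnn d) d

end EulerProduct

/-! ### Polynomials of the form `A² + T B²` -/

section NormForms

variable {F : Type*} [Field F]

theorem IsNormForm.mul {f g : F[X]} (hf : IsNormForm f) (hg : IsNormForm g) :
    IsNormForm (f * g) := by
  obtain ⟨A, B, rfl⟩ := hf
  obtain ⟨C, D, rfl⟩ := hg
  exact ⟨A * C - X * B * D, A * D + B * C, by ring⟩

theorem isNormForm_one : IsNormForm (1 : F[X]) := ⟨1, 0, by ring⟩

theorem isNormForm_X : IsNormForm (X : F[X]) := ⟨0, 1, by ring⟩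

theorem isNormForm_sq (f : F[X]) : IsNormForm (f ^ 2) := ⟨f, 0, by ring⟩

theorem IsNormForm.pow {f : F[X]} (hf : IsNormForm f) (k : ℕ) : IsNormForm (f ^ k) := by
  induction k with
  | zero => simpa using isNormForm_one
  | succ k ih => rw [pow_succ]; exact ih.mul hf

/-- The degrees of `A²` and `T B²` have different parity, so no cancellation occurs. -/
theorem sq_add_X_mul_sq_eq_zero {A B : F[X]} (h : A ^ 2 + X * B ^ 2 = 0) : A = 0 ∧ B = 0 := by
  by_cases hB : B = 0
  · subst hB
    simpa using h
  · exfalso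
    have h1 : A ^ 2 = -(X * B ^ 2) := eq_neg_of_add_eq_zero_left h
    have h2 := congrArg natDegree h1
    rw [natDegree_neg, natDegree_pow, natDegree_X_mul (pow_ne_zero 2 hB), natDegree_pow] at h2
    omega

/-- Thue's lemma: if `-T` is a square modulo `P`, then a nontrivial solution of `A ≡ D B` in which
`A` has degree at most `deg P / 2` and `B` degree at most `(deg P - 1) / 2` makes `A² + T B²` a
constant multiple of `P`. -/
theorem isNormForm_of_dvd {P D : F[X]} (hP : P.Monic) (hpos : 0 < P.natDegree)
    (h : P ∣ D ^ 2 + X) : IsNormForm P := by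
  set d := P.natDegree with hd
  let pb := AdjoinRoot.powerBasis hP.ne_zero
  have : FiniteDimensional F (AdjoinRoot P) := pb.finite
  have hfr : Module.finrank F (AdjoinRoot P) = d := by
    rw [pb.finrank, AdjoinRoot.powerBasis_dim]
  have hfd (n : ℕ) : FiniteDimensional F (degreeLT F n) :=
    Module.Finite.equiv (degreeLTEquiv F n).symm
  have hfrn (n : ℕ) : Module.finrank F (degreeLT F n) = n := by
    rw [(degreeLTEquiv F n).finrank_eq, Module.finrank_fin_fun]
  let mk : F[X] →ₗ[F] AdjoinRoot P := (AdjoinRoot.mkₐ P).toLinearMap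
  let φ : (degreeLT F (d / 2 + 1) × degreeLT F ((d - 1) / 2 + 1)) →ₗ[F] AdjoinRoot P :=
    LinearMap.coprod (mk ∘ₗ (degreeLT F (d / 2 + 1)).subtype)
      (-(mk ∘ₗ LinearMap.mulLeft F D ∘ₗ (degreeLT F ((d - 1) / 2 + 1)).subtype))
  -- The source of `φ` has dimension `d / 2 + 1 + (d - 1) / 2 + 1 = d + 1`.
  have hker : φ.ker ≠ ⊥ := by
    refine LinearMap.ker_ne_bot_of_finrank_lt ?_
    rw [Module.finrank_prod, hfr, hfrn, hfrn]
    omega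
  obtain ⟨⟨⟨A, hA⟩, ⟨B, hB⟩⟩, hAB, hne⟩ := Submodule.exists_mem_ne_zero_of_ne_bot hker
  have hdvd : P ∣ A - D * B := by
    rw [← AdjoinRoot.mk_eq_zero]
    rw [LinearMap.mem_ker] at hAB
    simpa [φ, mk, sub_eq_add_neg] using hAB
  have hdA : A.natDegree ≤ d / 2 := by
    rw [mem_degreeLT, degree_lt_iff_coeff_zero] at hA
    exact natDegree_le_iff_coeff_eq_zero.2 fun N hN ↦ hA N hN
  have hdB : B.natDegree ≤ (d - 1) / 2 := by
    rw [mem_degreeLT, degree_lt_iff_coeff_zero] at hB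
    exact natDegree_le_iff_coeff_eq_zero.2 fun N hN ↦ hB N hN
  have hdvd2 : P ∣ A ^ 2 + X * B ^ 2 := by
    have e : A ^ 2 + X * B ^ 2 = (A - D * B) * (A + D * B) + (D ^ 2 + X) * B ^ 2 := by ring
    rw [e]
    exact dvd_add (hdvd.mul_right _) (h.mul_right _)
  have hA2 : (A ^ 2).natDegree ≤ 2 * (d / 2) := by
    rw [natDegree_pow]; omega
  have hB2 : (X * B ^ 2).natDegree ≤ 2 * ((d - 1) / 2) + 1 := by
    refine natDegree_mul_le.trans ?_
    rw [natDegree_pow, natDegree_X]; omega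
  obtain ⟨Q, hQ⟩ := hdvd2
  have hQ0 : Q ≠ 0 := by
    rintro rfl
    rw [mul_zero] at hQ
    obtain ⟨rfl, rfl⟩ := sq_add_X_mul_sq_eq_zero hQ
    exact hne rfl
  have hQd : Q.natDegree = 0 := by
    have h1 : (A ^ 2 + X * B ^ 2).natDegree ≤ d := by
      refine (natDegree_add_le _ _).trans (max_le ?_ ?_) <;> omega
    rw [hQ, hP.natDegree_mul' hQ0] at h1
    omega
  obtain ⟨c, rfl⟩ := natDegree_eq_zero.1 hQd
  have hc0 : c ≠ 0 := by rintro rfl; simp at hQ0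
  have hcoef : c = (A ^ 2 + X * B ^ 2).coeff d := by
    rw [hQ, coeff_mul_C, hP.coeff_natDegree, one_mul]
  -- The leading coefficient `c` comes from `A²` or from `T B²`, according to the parity of `d`.
  obtain ⟨s, hs⟩ : ∃ s, c = s ^ 2 := by
    rcases Nat.even_or_odd' d with ⟨m, hm | hm⟩
    · refine ⟨A.coeff m, ?_⟩
      rw [hcoef, coeff_add, coeff_eq_zero_of_natDegree_lt (p := X * B ^ 2) (by omega), add_zero, hm,
        coeff_pow_of_natDegree_le (by omega)]
    · refine ⟨B.coeff m, ?_⟩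
      rw [hcoef, coeff_add, coeff_eq_zero_of_natDegree_lt (p := A ^ 2) (by omega), zero_add, hm,
        coeff_X_mul, coeff_pow_of_natDegree_le (by omega)]
  have hs0 : s ≠ 0 := by rintro rfl; simp at hs; exact hc0 hs
  refine ⟨A * C s⁻¹, B * C s⁻¹, ?_⟩
  have : (A * C s⁻¹) ^ 2 + X * (B * C s⁻¹) ^ 2 = (A ^ 2 + X * B ^ 2) * C (s⁻¹ ^ 2) := by
    rw [C_pow]; ring
  rw [this, hQ, mul_assoc, ← C_mul, hs, ← mul_pow, mul_inv_cancel₀ hs0]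
  simp

variable [Fintype F]

open Classical in
/-- The quadratic character of the constant coefficient. For a monic irreducible `P` this is the
Legendre symbol `(P / T)`. -/
noncomputable def constCoeffChar (f : F[X]) : ℤ := quadraticChar F (f.coeff 0)

theorem constCoeffChar_mul (f g : F[X]) :
    constCoeffChar (f * g) = constCoeffChar f * constCoeffChar g := by
  rw [constCoeffChar, mul_coeff_zero, map_mul]
  rfl

theorem constCoeffChar_one : constCoeffChar (1 : F[X]) = 1 := by
  simp [constCoeffChar]

theorem constCoeffChar_trichotomy (f : F[X]) :
    constCoeffChar f = 0 ∨ constCoeffChar f = 1 ∨ constCoeffChar f = -1 := by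
  classical
  unfold constCoeffChar
  by_cases h : f.coeff 0 = 0
  · left; simp [h]
  · right; exact quadraticChar_dichotomy h

theorem constCoeffChar_eq_zero_iff {P : F[X]} (hP : P.Monic) (hirr : Irreducible P) :
    constCoeffChar P = 0 ↔ P = X := by
  classical
  unfold constCoeffChar
  rw [quadraticChar_eq_zero_iff, ← X_dvd_iff]
  constructor
  · intro h
    exact (eq_of_monic_of_associated monic_X hP (irreducible_X.associated_of_dvd hirr h)).symm
  · rintro rfl; exact dvd_rfl

theorem ringChar_ne_two_of_odd_card (hodd : Odd (Fintype.card F)) : ringChar F ≠ 2 := by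
  intro h
  rw [FiniteField.even_card_iff_char_two] at h
  rw [Nat.odd_iff] at hodd
  omega

theorem legendre_X_eq_neg_one_iff (hodd : Odd (Fintype.card F)) (P : F[X]) :
    legendre P X = -1 ↔ constCoeffChar P = -1 := by
  classical
  have hF := ringChar_ne_two_of_odd_card hodd
  have h2 : (2 : F) ≠ 0 := Ring.two_ne_zero hF
  have hq : (absValue (X : F[X]) - 1) / 2 = Fintype.card F / 2 := by
    rw [absValue, natDegree_X, pow_one]
    obtain ⟨k, hk⟩ := hodd
    omega
  have hval := quadraticChar_eq_pow_of_char_ne_two' hF (P.coeff 0)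
  have e1 : (X : F[X]) ∣ P ^ (Fintype.card F / 2) - 1 ↔ ((constCoeffChar P : ℤ) : F) = 1 := by
    rw [X_dvd_iff, coeff_sub, coeff_zero_eq_eval_zero, eval_pow, ← coeff_zero_eq_eval_zero,
      coeff_one_zero, sub_eq_zero, ← hval]
    rfl
  have e2 : (X : F[X]) ∣ P ^ (Fintype.card F / 2) + 1 ↔ ((constCoeffChar P : ℤ) : F) = -1 := by
    rw [X_dvd_iff, coeff_add, coeff_zero_eq_eval_zero, eval_pow, ← coeff_zero_eq_eval_zero,
      coeff_one_zero, add_eq_zero_iff_eq_neg, ← hval]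
    rfl
  have h3 : (1 : F) ≠ -1 := fun h ↦ h2 (by linear_combination h)
  unfold legendre
  rw [hq]
  simp only [e1, e2]
  rcases constCoeffChar_trichotomy P with h | h | h <;> simp [h, h3.symm]

/-- The norm of `-T mod P` to `F` is `P(0)`; since `-T mod P` is a square precisely when its norm
is, `-T` is a square modulo `P` if and only if `P(0)` is a square. -/
theorem isSquare_neg_root_iff (hodd : Odd (Fintype.card F)) {P : F[X]} (hP : P.Monic)
    (hirr : Irreducible P) (h0 : P.coeff 0 ≠ 0) :
    IsSquare (-AdjoinRoot.root P) ↔ constCoeffChar P = 1 := by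
  classical
  have : Fact (Irreducible P) := ⟨hirr⟩
  have hF := ringChar_ne_two_of_odd_card hodd
  let pb := AdjoinRoot.powerBasis hP.ne_zero
  have hfin : Module.Finite F (AdjoinRoot P) := pb.finite
  have : Finite (AdjoinRoot P) := Module.finite_of_finite F
  let _ : Fintype (AdjoinRoot P) := Fintype.ofFinite _
  have hinj := (algebraMap F (AdjoinRoot P)).injective
  have hchar : ringChar (AdjoinRoot P) ≠ 2 := by
    rwa [← Algebra.ringChar_eq F (AdjoinRoot P)]
  have hcardK : Fintype.card (AdjoinRoot P) = Fintype.card F ^ P.natDegree := by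
    rw [Module.card_eq_pow_finrank (K := F), pb.finrank, AdjoinRoot.powerBasis_dim]
  have hroot : AdjoinRoot.root P ≠ 0 := by
    intro h
    rw [← AdjoinRoot.mk_X, AdjoinRoot.mk_eq_zero] at h
    have := eq_of_monic_of_associated hP monic_X (hirr.associated_of_dvd irreducible_X h)
    rw [this] at h0
    simp at h0
  have hnorm : Algebra.norm F (-AdjoinRoot.root P) = P.coeff 0 := by
    have h1 : Algebra.norm F (AdjoinRoot.root P) = (-1) ^ P.natDegree * P.coeff 0 := by
      have := Algebra.PowerBasis.norm_gen_eq_coeff_zero_minpoly pb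
      rw [AdjoinRoot.powerBasis_gen, AdjoinRoot.powerBasis_dim, AdjoinRoot.minpoly_root hP.ne_zero,
        hP.leadingCoeff] at this
      simpa using this
    have h2 : Algebra.norm F (-1 : AdjoinRoot P) = (-1) ^ P.natDegree := by
      have := Algebra.norm_algebraMap (S := AdjoinRoot P) (-1 : F)
      rwa [map_neg, map_one, pb.finrank, AdjoinRoot.powerBasis_dim] at this
    rw [← neg_one_mul, map_mul, h1, h2, ← mul_assoc, ← mul_pow]
    simp
  have hpow := FiniteField.algebraMap_norm_eq_pow (K := F) (x := -AdjoinRoot.root P)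
  rw [hnorm, Nat.card_eq_fintype_card, Nat.card_eq_fintype_card] at hpow
  rw [FiniteField.isSquare_iff hchar (neg_ne_zero.2 hroot)]
  -- Euler's criterion in `F[X] / P`, with `N = (q ^ d - 1) / (q - 1)`, reduces to the one in `F`.
  have hexp : Fintype.card (AdjoinRoot P) / 2
      = (Fintype.card (AdjoinRoot P) - 1) / (Fintype.card F - 1) * (Fintype.card F / 2) := by
    have hdvd : Fintype.card F - 1 ∣ Fintype.card (AdjoinRoot P) - 1 := by
      rw [hcardK]; simpa using Nat.sub_dvd_pow_sub_pow (Fintype.card F) 1 P.natDegree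
    obtain ⟨N, hN⟩ := hdvd
    have hq1 := Fintype.one_lt_card (α := F)
    have hK1 := Fintype.one_lt_card (α := AdjoinRoot P)
    rw [hN, Nat.mul_div_cancel_left _ (by omega)]
    have hoddK : Odd (Fintype.card (AdjoinRoot P)) := by rw [hcardK]; exact hodd.pow
    obtain ⟨k, hk⟩ := hodd
    obtain ⟨l, hl⟩ := hoddK
    have e1 : Fintype.card F / 2 = k := by omega
    have e2 : Fintype.card (AdjoinRoot P) / 2 = l := by omega
    rw [e1, e2]
    have : 2 * l = 2 * (N * k) := by
      calc 2 * l = Fintype.card (AdjoinRoot P) - 1 := by omega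
        _ = 2 * k * N := by rw [hN]; congr 1; omega
        _ = 2 * (N * k) := by ring
    omega
  rw [hexp, pow_mul, ← hpow, ← map_pow, ← quadraticChar_eq_pow_of_char_ne_two' hF]
  change algebraMap F (AdjoinRoot P) ((constCoeffChar P : ℤ) : F) = 1 ↔ _
  have h2 : (2 : F) ≠ 0 := Ring.two_ne_zero hF
  have h3 : (-1 : F) ≠ 1 := fun h ↦ h2 (by linear_combination -h)
  rw [← map_one (algebraMap F (AdjoinRoot P)), hinj.eq_iff]
  rcases constCoeffChar_trichotomy P with h | h | h <;> simp [h, h3]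

theorem isNormForm_of_constCoeffChar_eq_one (hodd : Odd (Fintype.card F)) {P : F[X]}
    (hP : P.Monic) (hirr : Irreducible P) (h : constCoeffChar P = 1) : IsNormForm P := by
  have h0 : P.coeff 0 ≠ 0 := by
    intro h'
    simp [constCoeffChar, h'] at h
  obtain ⟨c, hc⟩ := (isSquare_neg_root_iff hodd hP hirr h0).2 h
  obtain ⟨D, rfl⟩ := AdjoinRoot.mk_surjective c
  refine isNormForm_of_dvd hP hirr.natDegree_pos (D := D) ?_
  rw [← AdjoinRoot.mk_eq_zero, map_add, map_pow, AdjoinRoot.mk_X, sq, ← hc]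
  simp

/-- An inert prime dividing `A² + T B²` divides `A` and `B`, since `-T` is not a square
modulo it. -/
theorem dvd_and_dvd_of_dvd_sq_add (hodd : Odd (Fintype.card F)) {P A B : F[X]} (hP : P.Monic)
    (hirr : Irreducible P) (h : constCoeffChar P = -1) (hdvd : P ∣ A ^ 2 + X * B ^ 2) :
    P ∣ A ∧ P ∣ B := by
  have : Fact (Irreducible P) := ⟨hirr⟩
  have h0 : P.coeff 0 ≠ 0 := by
    intro h'
    simp [constCoeffChar, h'] at h
  have hB : P ∣ B := by
    by_contra hB
    rw [← AdjoinRoot.mk_eq_zero] at hB hdvd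
    have hsq : IsSquare (-AdjoinRoot.root P) := by
      refine ⟨AdjoinRoot.mk P A / AdjoinRoot.mk P B, ?_⟩
      rw [map_add, map_mul, map_pow, map_pow, AdjoinRoot.mk_X] at hdvd
      field_simp
      linear_combination -hdvd
    rw [isSquare_neg_root_iff hodd hP hirr h0, h] at hsq
    norm_num at hsq
  have hA : P ∣ A ^ 2 := by
    rw [← dvd_add_left ((dvd_pow hB two_ne_zero).mul_left X)]
    exact hdvd
  exact ⟨hirr.prime.dvd_of_dvd_pow hA, hB⟩

/-- An inert prime occurs to an even power in a polynomial of the form `A² + T B²`. -/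
theorem IsNormForm.even_of_eq_pow_mul (hodd : Odd (Fintype.card F)) {P : F[X]} (hP : P.Monic)
    (hirr : Irreducible P) (h : constCoeffChar P = -1) (k : ℕ) {f g : F[X]} (hf : IsNormForm f)
    (hfg : f = P ^ k * g) (hg : ¬P ∣ g) : Even k := by
  induction k using Nat.strong_induction_on generalizing f with
  | _ k ih =>
    rcases Nat.eq_zero_or_pos k with rfl | hk
    · exact Even.zero
    obtain ⟨A, B, hAB⟩ := hf
    have hPf : P ∣ f := hfg ▸ (dvd_pow_self P hk.ne').mul_right g
    obtain ⟨⟨A', rfl⟩, ⟨B', rfl⟩⟩ := dvd_and_dvd_of_dvd_sq_add hodd hP hirr h (hAB ▸ hPf)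
    have e : P ^ 2 * (A' ^ 2 + X * B' ^ 2) = P ^ k * g := by rw [← hfg, hAB]; ring
    rcases Nat.lt_or_ge k 2 with hk2 | hk2
    · obtain rfl : k = 1 := by omega
      have : P * (P * (A' ^ 2 + X * B' ^ 2)) = P * g := by rw [← mul_assoc, ← sq, e, pow_one]
      exact absurd ⟨_, (mul_left_cancel₀ hP.ne_zero this).symm⟩ hg
    · obtain ⟨l, rfl⟩ := Nat.exists_eq_add_of_le hk2
      rw [pow_add, mul_assoc] at e
      have := mul_left_cancel₀ (pow_ne_zero 2 hP.ne_zero) e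
      exact (even_two).add (ih l (by omega) ⟨A', B', rfl⟩ this)

end NormForms

/-! ### Factorization of monic polynomials -/

section MonicPrimes

variable {F : Type*} [Field F]

/-- The monic irreducible polynomials over `F`. -/
abbrev MonicPrime (F : Type*) [Field F] : Type _ := {P : F[X] // P.Monic ∧ Irreducible P}

/-- The monic polynomial with a given factorization, recorded by the exponents of the monic
irreducible polynomials. -/
noncomputable def primeProd (d : MonicPrime F →₀ ℕ) : F[X] := d.prod fun P k ↦ P.1 ^ k

theorem primeProd_zero : primeProd (0 : MonicPrime F →₀ ℕ) = 1 := Finsupp.prod_zero_index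

theorem primeProd_add (d e : MonicPrime F →₀ ℕ) :
    primeProd (d + e) = primeProd d * primeProd e := by
  classical
  exact Finsupp.prod_add_index' (fun _ ↦ pow_zero _) fun _ _ _ ↦ pow_add _ _ _

theorem primeProd_single (P : MonicPrime F) (k : ℕ) :
    primeProd (Finsupp.single P k) = P.1 ^ k :=
  Finsupp.prod_single_index (pow_zero _)

theorem monic_primeProd (d : MonicPrime F →₀ ℕ) : (primeProd d).Monic :=
  monic_prod_of_monic _ _ fun P _ ↦ P.2.1.pow _

/-- The degrees of the monic irreducible polynomials, as weights. -/
noncomputable def primeDegree (P : MonicPrime F) : ℕ := P.1.natDegree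

theorem natDegree_primeProd (d : MonicPrime F →₀ ℕ) :
    (primeProd d).natDegree = Finsupp.weight primeDegree d := by
  rw [primeProd, Finsupp.prod, natDegree_prod_of_monic _ _ fun P _ ↦ P.2.1.pow _,
    Finsupp.weight_apply, Finsupp.sum]
  refine Finset.sum_congr rfl fun P _ ↦ ?_
  rw [P.2.1.natDegree_pow, smul_eq_mul]
  rfl

theorem primeProd_eq_pow_mul_erase (d : MonicPrime F →₀ ℕ) (P : MonicPrime F) :
    primeProd d = P.1 ^ d P * primeProd (d.erase P) := by
  conv_lhs => rw [← Finsupp.single_add_erase P d]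
  rw [primeProd_add, primeProd_single]

theorem not_dvd_primeProd_erase (d : MonicPrime F →₀ ℕ) (P : MonicPrime F) :
    ¬P.1 ∣ primeProd (d.erase P) := by
  classical
  intro h
  rw [primeProd, Finsupp.prod, Prime.dvd_finsetProd_iff P.2.2.prime] at h
  obtain ⟨Q, hQ, hPQ⟩ := h
  rw [Finsupp.support_erase, Finset.mem_erase] at hQ
  refine hQ.1 (Subtype.ext ?_)
  have := P.2.2.prime.dvd_of_dvd_pow hPQ
  exact (eq_of_monic_of_associated P.2.1 Q.2.1 (P.2.2.associated_of_dvd Q.2.2 this)).symm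

theorem eq_of_pow_mul_eq_pow_mul {P g g' : F[X]} (hP : P ≠ 0) {a b : ℕ} (hg : ¬P ∣ g)
    (hg' : ¬P ∣ g') (h : P ^ a * g = P ^ b * g') : a = b := by
  wlog hab : a ≤ b generalizing a b g g'
  · exact (this hg' hg h.symm (not_le.1 hab).le).symm
  obtain ⟨c, rfl⟩ := Nat.exists_eq_add_of_le hab
  rw [pow_add, mul_assoc] at h
  have h' := mul_left_cancel₀ (pow_ne_zero a hP) h
  rcases Nat.eq_zero_or_pos c with rfl | hc
  · rfl
  · exact absurd (h' ▸ (dvd_pow_self P hc.ne').mul_right g') hg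

theorem primeProd_injective : Function.Injective (primeProd (F := F)) := by
  intro d e h
  ext P
  rw [primeProd_eq_pow_mul_erase d P, primeProd_eq_pow_mul_erase e P] at h
  exact eq_of_pow_mul_eq_pow_mul P.2.1.ne_zero (not_dvd_primeProd_erase d P)
    (not_dvd_primeProd_erase e P) h

theorem exists_primeProd_eq {f : F[X]} (hf : f.Monic) :
    ∃ d : MonicPrime F →₀ ℕ, primeProd d = f := by
  classical
  have key : ∀ s : Multiset F[X], (∀ P ∈ s, P.Monic ∧ Irreducible P) →
      ∃ d : MonicPrime F →₀ ℕ, primeProd d = s.prod := by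
    intro s
    induction s using Multiset.induction_on with
    | empty => exact fun _ ↦ ⟨0, by simp [primeProd_zero]⟩
    | cons P s ih =>
      intro h
      obtain ⟨d, hd⟩ := ih fun Q hQ ↦ h Q (Multiset.mem_cons_of_mem hQ)
      refine ⟨Finsupp.single ⟨P, h P (Multiset.mem_cons_self P s)⟩ 1 + d, ?_⟩
      rw [primeProd_add, primeProd_single, hd, Multiset.prod_cons, pow_one]
  obtain ⟨d, hd⟩ := key (UniqueFactorizationMonoid.normalizedFactors f) fun P hP ↦ by
    have hirr := UniqueFactorizationMonoid.irreducible_of_normalized_factor P hP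
    refine ⟨?_, hirr⟩
    rw [← UniqueFactorizationMonoid.normalize_normalized_factor P hP]
    exact monic_normalize hirr.ne_zero
  exact ⟨d, by rw [hd, UniqueFactorizationMonoid.prod_normalizedFactors_eq hf.ne_zero,
    hf.normalize_eq_self]⟩

variable [Fintype F]

theorem finite_weight_primeDegree_eq (n : ℕ) :
    {d : MonicPrime F →₀ ℕ | Finsupp.weight primeDegree d = n}.Finite := by
  refine Set.Finite.of_finite_image ((finite_monicOfDegree F n).subset ?_)
    primeProd_injective.injOn
  rintro _ ⟨d, hd, rfl⟩
  exact ⟨monic_primeProd d, (natDegree_primeProd d).trans hd⟩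

/-- The generating function by degree of a function on monic polynomials, the polynomials being
given by their factorizations. -/
noncomputable def degreeSeries (f : MvPowerSeries (MonicPrime F) ℝ) : PowerSeries ℝ :=
  weightSeries primeDegree finite_weight_primeDegree_eq f

theorem coeff_degreeSeries_eq_sum_monic (f : MvPowerSeries (MonicPrime F) ℝ) (g : F[X] → ℝ)
    (hfg : ∀ d, MvPowerSeries.coeff d f = g (primeProd d)) (n : ℕ) :
    PowerSeries.coeff n (degreeSeries f) = ∑ p ∈ (finite_monicOfDegree F n).toFinset, g p := by
  rw [degreeSeries, coeff_weightSeries]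
  refine Finset.sum_bij (fun d _ ↦ primeProd d) ?_ ?_ ?_ fun d _ ↦ hfg d
  · intro d hd
    rw [Set.Finite.mem_toFinset] at hd ⊢
    exact ⟨monic_primeProd d, (natDegree_primeProd d).trans hd⟩
  · intro d _ e _ h
    exact primeProd_injective h
  · intro p hp
    rw [Set.Finite.mem_toFinset] at hp
    obtain ⟨d, rfl⟩ := exists_primeProd_eq hp.1
    exact ⟨d, by
      rw [Set.Finite.mem_toFinset]; exact (natDegree_primeProd d).symm.trans hp.2, rfl⟩

theorem card_monicOfDegree (n : ℕ) :
    (finite_monicOfDegree F n).toFinset.card = Fintype.card F ^ n := by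
  rw [← Set.ncard_eq_toFinset_card _ (finite_monicOfDegree F n)]
  change Nat.card {p : F[X] // p.Monic ∧ p.natDegree = n} = _
  rw [Nat.card_congr (monicEquivDegreeLT n), Nat.card_congr (degreeLTEquiv F n).toEquiv]
  simp

/-- Scaling the constant coefficient by a nonsquare is a permutation of the monic polynomials of
a positive degree, and it reverses the sign of the character. -/
theorem sum_constCoeffChar_eq_zero (hodd : Odd (Fintype.card F)) {n : ℕ} (hn : 0 < n) :
    ∑ p ∈ (finite_monicOfDegree F n).toFinset, (constCoeffChar p : ℝ) = 0 := by
  classical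
  obtain ⟨u, hu⟩ := quadraticChar_exists_neg_one (ringChar_ne_two_of_odd_card hodd)
  have hu0 : u ≠ 0 := by rintro rfl; simp at hu
  let s (v : F) (p : F[X]) : F[X] := p + C ((v - 1) * p.coeff 0)
  have hs0 (v : F) (p : F[X]) : (s v p).coeff 0 = v * p.coeff 0 := by
    simp only [s, coeff_add, coeff_C_zero]; ring
  have hinv {v w : F} (h : w * v = 1) (p : F[X]) : s w (s v p) = p := by
    have : s w (s v p) = p + C ((v - 1) * p.coeff 0) + C ((w - 1) * (s v p).coeff 0) := rfl
    rw [this, hs0, add_assoc, ← C_add,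
      show (v - 1) * p.coeff 0 + (w - 1) * (v * p.coeff 0) = 0 by linear_combination p.coeff 0 * h]
    simp
  have hmem (v : F) : ∀ p ∈ (finite_monicOfDegree F n).toFinset,
      s v p ∈ (finite_monicOfDegree F n).toFinset := by
    intro p hp
    rw [Set.Finite.mem_toFinset] at hp ⊢
    have hdeg : (C ((v - 1) * p.coeff 0)).degree < p.degree := by
      refine degree_C_le.trans_lt ?_
      rw [degree_eq_natDegree hp.1.ne_zero, hp.2]
      exact_mod_cast hn
    exact ⟨hp.1.add_of_left hdeg, by rw [natDegree_add_C]; exact hp.2⟩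
  have hneg : ∑ p ∈ (finite_monicOfDegree F n).toFinset, (constCoeffChar p : ℝ)
      = ∑ p ∈ (finite_monicOfDegree F n).toFinset, -(constCoeffChar p : ℝ) := by
    refine Finset.sum_nbij' (s u) (s u⁻¹) (hmem u) (hmem u⁻¹)
      (fun p _ ↦ hinv (inv_mul_cancel₀ hu0) p) (fun p _ ↦ hinv (mul_inv_cancel₀ hu0) p)
      fun p _ ↦ ?_
    have : constCoeffChar (s u p) = -constCoeffChar p := by
      unfold constCoeffChar
      rw [hs0, map_mul]
      convert neg_one_mul _ using 2
    rw [this]; push_cast; ring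
  rw [Finset.sum_neg_distrib] at hneg
  linarith

end MonicPrimes

/-! ### Local factors and their generating functions -/

section LocalFactors

variable {F : Type*} [Field F] [Fintype F]

/-- The geometric series `1 / (1 - X)`. -/
noncomputable def geomSeries : PowerSeries ℝ := PowerSeries.mk fun _ ↦ 1

/-- Substitution of `X²` for `X`. -/
noncomputable def expandTwo : PowerSeries ℝ →ₐ[ℝ] PowerSeries ℝ :=
  PowerSeries.expand 2 two_ne_zero

theorem coeff_expandTwo (f : PowerSeries ℝ) (k : ℕ) :
    PowerSeries.coeff k (expandTwo f) = if 2 ∣ k then PowerSeries.coeff (k / 2) f else 0 :=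
  PowerSeries.coeff_expand 2 two_ne_zero f

theorem geomSeries_mul_rescale_neg_one :
    geomSeries * PowerSeries.rescale (-1) geomSeries = expandTwo geomSeries := by
  have h1 : geomSeries * (1 - PowerSeries.X) = 1 := mk_one_mul_one_sub_X
  have h2 : PowerSeries.rescale (-1) geomSeries * (1 + PowerSeries.X) = 1 := by
    have := congrArg (PowerSeries.rescale (-1 : ℝ)) h1
    simpa [PowerSeries.rescale_X] using this
  have h3 : expandTwo geomSeries * (1 - PowerSeries.X ^ 2) = 1 := by
    have := congrArg expandTwo h1
    simpa [expandTwo] using this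
  calc geomSeries * PowerSeries.rescale (-1) geomSeries
      = geomSeries * PowerSeries.rescale (-1) geomSeries *
          (expandTwo geomSeries * (1 - PowerSeries.X ^ 2)) := by rw [h3, mul_one]
    _ = (geomSeries * (1 - PowerSeries.X)) *
          (PowerSeries.rescale (-1) geomSeries * (1 + PowerSeries.X)) * expandTwo geomSeries := by
        ring
    _ = _ := by rw [h1, h2, one_mul, one_mul]

/-- The local factors of the indicator function of norm forms. -/
noncomputable def normFactor (P : MonicPrime F) : PowerSeries ℝ :=
  if constCoeffChar P.1 = -1 then expandTwo geomSeries else geomSeries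

/-- The local factors of the indicator function of the powers of `T`. -/
noncomputable def ramifiedFactor (P : MonicPrime F) : PowerSeries ℝ :=
  if constCoeffChar P.1 = 0 then geomSeries else 1

/-- The local factors of the constant function `1`. -/
noncomputable def zetaFactor (_ : MonicPrime F) : PowerSeries ℝ := geomSeries

/-- The local factors of the completely multiplicative function `constCoeffChar`. -/
noncomputable def charFactor (P : MonicPrime F) : PowerSeries ℝ :=
  PowerSeries.rescale (constCoeffChar P.1 : ℝ) geomSeries

/-- The local factors `(1 - X²) ^ (-1/2)` at the inert primes. -/
noncomputable def inertFactor (P : MonicPrime F) : PowerSeries ℝ :=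
  if constCoeffChar P.1 = -1 then expandTwo invSqrtSeries else 1

theorem constantCoeff_geomSeries : PowerSeries.constantCoeff geomSeries = 1 := by
  simp [geomSeries]

theorem constantCoeff_invSqrtSeries : PowerSeries.constantCoeff invSqrtSeries = 1 := by
  simp [invSqrtSeries, invSqrtCoeff_zero]

theorem constantCoeff_normFactor (P : MonicPrime F) :
    PowerSeries.constantCoeff (normFactor P) = 1 := by
  unfold normFactor; split_ifs <;> simp [expandTwo, constantCoeff_geomSeries]

theorem constantCoeff_ramifiedFactor (P : MonicPrime F) :
    PowerSeries.constantCoeff (ramifiedFactor P) = 1 := by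
  unfold ramifiedFactor; split_ifs <;> simp [constantCoeff_geomSeries]

theorem constantCoeff_charFactor (P : MonicPrime F) :
    PowerSeries.constantCoeff (charFactor P) = 1 := by
  rw [charFactor, ← PowerSeries.coeff_zero_eq_constantCoeff_apply, PowerSeries.coeff_rescale]
  simp [constantCoeff_geomSeries]

theorem constantCoeff_inertFactor (P : MonicPrime F) :
    PowerSeries.constantCoeff (inertFactor P) = 1 := by
  unfold inertFactor; split_ifs <;> simp [expandTwo, constantCoeff_invSqrtSeries]

theorem normFactor_mul_self : normFactor (F := F) * normFactor =
    ramifiedFactor * (zetaFactor * (charFactor * (inertFactor * inertFactor))) := by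
  funext P
  have h3 : (-1 : ℤ) ≠ 0 := by norm_num
  simp only [Pi.mul_apply, normFactor, ramifiedFactor, zetaFactor, charFactor, inertFactor]
  -- The cases `P = T`, `P` split and `P` inert.
  rcases constCoeffChar_trichotomy P.1 with h | h | h
  · simp [h, constantCoeff_geomSeries]
  · simp [h]
  · have hsq : expandTwo invSqrtSeries * expandTwo invSqrtSeries = expandTwo geomSeries := by
      rw [← map_mul, ← sq, invSqrtSeries_sq]; rfl
    simp only [h, if_true, h3, if_false, Int.cast_neg, Int.cast_one, one_mul]
    rw [hsq, ← mul_assoc, geomSeries_mul_rescale_neg_one]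

theorem degreeSeries_mul (f g : MvPowerSeries (MonicPrime F) ℝ) :
    degreeSeries (f * g) = degreeSeries f * degreeSeries g := weightSeries_mul f g

/-- Sum over all monic polynomials: the zeta function `1 / (1 - q X)`. -/
theorem degreeSeries_zeta : degreeSeries (mulSeries (zetaFactor (F := F))) =
    PowerSeries.rescale (Fintype.card F : ℝ) geomSeries := by
  ext n
  rw [coeff_degreeSeries_eq_sum_monic _ (fun _ ↦ 1), PowerSeries.coeff_rescale]
  · simp [card_monicOfDegree, geomSeries]
  · intro d
    rw [coeff_mulSeries]
    simp [zetaFactor, geomSeries]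

theorem constCoeffChar_primeProd (d : MonicPrime F →₀ ℕ) :
    constCoeffChar (primeProd d) = d.prod fun P k ↦ constCoeffChar P.1 ^ k := by
  let φ : F[X] →* ℤ :=
    { toFun := constCoeffChar, map_one' := constCoeffChar_one, map_mul' := constCoeffChar_mul }
  change φ (d.prod fun P k ↦ P.1 ^ k) = d.prod fun P k ↦ φ P.1 ^ k
  simp [Finsupp.prod]

/-- The `L`-function of the character is `1`. -/
theorem degreeSeries_char (hodd : Odd (Fintype.card F)) :
    degreeSeries (mulSeries (charFactor (F := F))) = 1 := by
  ext n
  rw [coeff_degreeSeries_eq_sum_monic _ (fun p ↦ (constCoeffChar p : ℝ))]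
  · rcases Nat.eq_zero_or_pos n with rfl | hn
    · have : (finite_monicOfDegree F 0).toFinset = {1} := by
        ext p
        rw [Set.Finite.mem_toFinset, Finset.mem_singleton]
        exact ⟨fun h ↦ h.1.natDegree_eq_zero.1 h.2, fun h ↦ h ▸ ⟨monic_one, natDegree_one⟩⟩
      simp [this, constCoeffChar_one]
    · rw [sum_constCoeffChar_eq_zero hodd hn, PowerSeries.coeff_one, if_neg hn.ne']
  · intro d
    rw [coeff_mulSeries, constCoeffChar_primeProd]
    simp [charFactor, geomSeries, Finsupp.prod, PowerSeries.coeff_rescale]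

/-- Sum over the powers of `T`. -/
theorem degreeSeries_ramified : degreeSeries (mulSeries (ramifiedFactor (F := F))) =
    geomSeries := by
  classical
  let T : MonicPrime F := ⟨X, monic_X, irreducible_X⟩
  have hT : constCoeffChar T.1 = 0 := (constCoeffChar_eq_zero_iff monic_X irreducible_X).2 rfl
  ext n
  rw [degreeSeries, coeff_weightSeries, Finset.sum_eq_single (Finsupp.single T n)]
  · rw [coeff_mulSeries, Finsupp.prod_single_index]
    · simp [ramifiedFactor, hT, geomSeries]
    · simp [constantCoeff_ramifiedFactor]
  · intro d hd hne
    rw [Set.Finite.mem_toFinset] at hd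
    obtain ⟨P, hP, hPT⟩ : ∃ P ∈ d.support, P ≠ T := by
      by_contra! hall
      refine hne ?_
      have hsupp : d.support ⊆ {T} := fun P hP ↦ Finset.mem_singleton.2 (hall P hP)
      obtain ⟨k, rfl⟩ := Finsupp.support_subset_singleton'.1 hsupp
      have hd' : Finsupp.weight primeDegree (Finsupp.single T k) = n := hd
      rw [Finsupp.weight_single] at hd'
      have : primeDegree T = 1 := natDegree_X
      rw [this, smul_eq_mul, mul_one] at hd'
      rw [hd']
    rw [coeff_mulSeries]
    refine Finset.prod_eq_zero hP ?_
    have hPc : constCoeffChar P.1 ≠ 0 := fun h ↦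
      hPT (Subtype.ext ((constCoeffChar_eq_zero_iff P.2.1 P.2.2).1 h))
    have hfac : ramifiedFactor P = 1 := if_neg hPc
    change PowerSeries.coeff (d P) (ramifiedFactor P) = 0
    rw [hfac, PowerSeries.coeff_one, if_neg (Finsupp.mem_support_iff.1 hP)]
  · intro h
    refine absurd ?_ h
    rw [Set.Finite.mem_toFinset]
    change Finsupp.weight primeDegree (Finsupp.single T n) = n
    rw [Finsupp.weight_single]
    have : primeDegree T = 1 := natDegree_X
    rw [this, smul_eq_mul, mul_one]

theorem isNormForm_primeProd_iff (hodd : Odd (Fintype.card F)) (d : MonicPrime F →₀ ℕ) :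
    IsNormForm (primeProd d) ↔ ∀ P, constCoeffChar P.1 = -1 → Even (d P) := by
  classical
  constructor
  · intro h P hP
    exact h.even_of_eq_pow_mul hodd P.2.1 P.2.2 hP _ (primeProd_eq_pow_mul_erase d P)
      (not_dvd_primeProd_erase d P)
  · intro h
    refine Finset.prod_induction _ IsNormForm (fun _ _ ↦ IsNormForm.mul) isNormForm_one
      fun P _ ↦ ?_
    change IsNormForm (P.1 ^ d P)
    rcases constCoeffChar_trichotomy P.1 with hP | hP | hP
    · rw [(constCoeffChar_eq_zero_iff P.2.1 P.2.2).1 hP]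
      exact isNormForm_X.pow _
    · exact (isNormForm_of_constCoeffChar_eq_one hodd P.2.1 P.2.2 hP).pow _
    · obtain ⟨k, hk⟩ := (h P hP).two_dvd
      rw [hk, mul_comm, pow_mul]
      exact isNormForm_sq _

theorem degreeSeries_norm (hodd : Odd (Fintype.card F)) :
    degreeSeries (mulSeries (normFactor (F := F))) =
      PowerSeries.mk fun n ↦ (normCount F n : ℝ) := by
  classical
  ext n
  rw [coeff_degreeSeries_eq_sum_monic _ (fun p ↦ if IsNormForm p then 1 else 0)]
  · rw [PowerSeries.coeff_mk, Finset.sum_boole, normCount]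
    congr 1
    rw [← Set.ncard_coe_finset]
    congr 1
    ext p
    simp [and_comm]
  · intro d
    rw [coeff_mulSeries, isNormForm_primeProd_iff hodd]
    have hval (P : MonicPrime F) (k : ℕ) : PowerSeries.coeff k (normFactor P)
        = if constCoeffChar P.1 = -1 → Even k then 1 else 0 := by
      unfold normFactor
      split_ifs with h1 h2 h2
      · rw [coeff_expandTwo, if_pos (h2 h1).two_dvd]; simp [geomSeries]
      · rw [coeff_expandTwo, if_neg fun h ↦ h2 fun _ ↦ even_iff_two_dvd.2 h]
      · simp [geomSeries]
      · exact absurd (fun h ↦ absurd h h1) h2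
    simp_rw [hval]
    rw [Finsupp.prod, Finset.prod_boole]
    refine if_congr ⟨fun h P hP ↦ ?_, fun h P _ hP ↦ h P hP⟩ rfl rfl
    by_cases hd : P ∈ d.support
    · exact h P hd hP
    · rw [Finsupp.notMem_support_iff.1 hd]; exact Even.zero

end LocalFactors

/-! ### The generating function of the norm forms -/

section InertSeries

variable {F : Type*} [Field F] [Fintype F]

/-- The power series of `∏ (1 - u ^ (2 deg P)) ^ (-1/2)` over the inert primes `P`. -/
noncomputable def inertSeries (F : Type*) [Field F] [Fintype F] : PowerSeries ℝ :=
  degreeSeries (mulSeries (inertFactor (F := F)))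

theorem coeff_inertFactor_nonneg (P : MonicPrime F) (k : ℕ) :
    0 ≤ PowerSeries.coeff k (inertFactor P) := by
  unfold inertFactor
  split_ifs
  · rw [coeff_expandTwo]
    split_ifs
    · simpa [invSqrtSeries] using invSqrtCoeff_nonneg _
    · exact le_rfl
  · rw [PowerSeries.coeff_one]; split_ifs <;> norm_num

theorem coeff_inertFactor_le_one (P : MonicPrime F) (k : ℕ) :
    PowerSeries.coeff k (inertFactor P) ≤ 1 := by
  unfold inertFactor
  split_ifs
  · rw [coeff_expandTwo]
    split_ifs
    · simpa [invSqrtSeries] using invSqrtCoeff_le_one _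
    · exact zero_le_one
  · rw [PowerSeries.coeff_one]; split_ifs <;> norm_num

theorem coeff_inertFactor_of_odd (P : MonicPrime F) {k : ℕ} (hk : ¬2 ∣ k) :
    PowerSeries.coeff k (inertFactor P) = 0 := by
  unfold inertFactor
  split_ifs
  · rw [coeff_expandTwo, if_neg hk]
  · rw [PowerSeries.coeff_one, if_neg]
    rintro rfl
    exact hk (dvd_zero 2)

theorem coeff_mulSeries_inertFactor_nonneg (d : MonicPrime F →₀ ℕ) :
    0 ≤ MvPowerSeries.coeff d (mulSeries inertFactor) := by
  rw [coeff_mulSeries]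
  exact Finset.prod_nonneg fun P _ ↦ coeff_inertFactor_nonneg P _

theorem coeff_mulSeries_inertFactor_le_one (d : MonicPrime F →₀ ℕ) :
    MvPowerSeries.coeff d (mulSeries inertFactor) ≤ 1 := by
  rw [coeff_mulSeries]
  exact Finset.prod_le_one (fun P _ ↦ coeff_inertFactor_nonneg P _)
    fun P _ ↦ coeff_inertFactor_le_one P _

theorem exists_eq_two_nsmul_of_coeff_ne_zero {d : MonicPrime F →₀ ℕ}
    (h : MvPowerSeries.coeff d (mulSeries inertFactor) ≠ 0) :
    ∃ e : MonicPrime F →₀ ℕ, d = 2 • e := by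
  refine ⟨d.mapRange (· / 2) (Nat.zero_div 2), ?_⟩
  ext P
  rw [Finsupp.smul_apply, Finsupp.mapRange_apply, smul_eq_mul]
  by_cases hP : P ∈ d.support
  · refine (Nat.mul_div_cancel' ?_).symm
    by_contra hodd
    refine h ?_
    rw [coeff_mulSeries]
    exact Finset.prod_eq_zero hP (coeff_inertFactor_of_odd P hodd)
  · simp [Finsupp.notMem_support_iff.1 hP]

theorem coeff_inertSeries (n : ℕ) : PowerSeries.coeff n (inertSeries F) =
    ∑ d ∈ (finite_weight_primeDegree_eq n).toFinset,
      MvPowerSeries.coeff d (mulSeries (inertFactor (F := F))) :=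
  coeff_weightSeries _ n

theorem coeff_inertSeries_nonneg (n : ℕ) : 0 ≤ PowerSeries.coeff n (inertSeries F) := by
  rw [coeff_inertSeries]
  exact Finset.sum_nonneg fun d _ ↦ coeff_mulSeries_inertFactor_nonneg d

theorem card_weight_primeDegree_eq (n : ℕ) :
    ((finite_weight_primeDegree_eq (F := F) n).toFinset.card : ℝ) = (Fintype.card F : ℝ) ^ n := by
  have h := congrArg (PowerSeries.coeff n) (degreeSeries_zeta (F := F))
  rw [degreeSeries, coeff_weightSeries, PowerSeries.coeff_rescale] at h
  simpa [coeff_mulSeries, zetaFactor, geomSeries] using h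

/-- Only perfect squares contribute to the coefficients of `inertSeries`, so that these are about
the square root of the number of all monic polynomials of the same degree. -/
theorem coeff_inertSeries_le (n : ℕ) :
    PowerSeries.coeff n (inertSeries F) ≤ √(Fintype.card F : ℝ) ^ n := by
  classical
  rw [coeff_inertSeries]
  rcases Nat.even_or_odd' n with ⟨m, rfl | rfl⟩
  · rw [pow_mul, Real.sq_sqrt (Nat.cast_nonneg _), ← card_weight_primeDegree_eq]
    set S := (finite_weight_primeDegree_eq (F := F) m).toFinset
    calc ∑ d ∈ (finite_weight_primeDegree_eq (2 * m)).toFinset,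
          MvPowerSeries.coeff d (mulSeries (inertFactor (F := F)))
        ≤ ∑ d ∈ S.image (2 • ·), MvPowerSeries.coeff d (mulSeries (inertFactor (F := F))) := by
          rw [← Finset.sum_filter_ne_zero]
          refine Finset.sum_le_sum_of_subset_of_nonneg (fun d hd ↦ ?_)
            fun d _ _ ↦ coeff_mulSeries_inertFactor_nonneg d
          obtain ⟨hd, hne⟩ := Finset.mem_filter.1 hd
          obtain ⟨e, rfl⟩ := exists_eq_two_nsmul_of_coeff_ne_zero hne
          refine Finset.mem_image_of_mem _ ?_
          rw [Set.Finite.mem_toFinset, Set.mem_ofPred_eq, map_nsmul, smul_eq_mul] at hd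
          rw [Set.Finite.mem_toFinset, Set.mem_ofPred_eq]
          omega
      _ ≤ ∑ _d ∈ S.image (2 • ·), (1 : ℝ) :=
          Finset.sum_le_sum fun d _ ↦ coeff_mulSeries_inertFactor_le_one d
      _ ≤ S.card := by
          rw [Finset.sum_const, nsmul_eq_mul, mul_one]
          exact_mod_cast Finset.card_image_le
  · rw [Finset.sum_eq_zero]
    · positivity
    · intro d hd
      by_contra hne
      obtain ⟨e, rfl⟩ := exists_eq_two_nsmul_of_coeff_ne_zero hne
      rw [Set.Finite.mem_toFinset, Set.mem_ofPred_eq, map_nsmul, smul_eq_mul] at hd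
      omega

theorem coeff_zero_inertSeries_pos : 0 < PowerSeries.coeff 0 (inertSeries F) := by
  rw [coeff_inertSeries]
  have h0 : (0 : MonicPrime F →₀ ℕ) ∈ (finite_weight_primeDegree_eq (F := F) 0).toFinset := by
    rw [Set.Finite.mem_toFinset, Set.mem_ofPred_eq, map_zero]
  refine lt_of_lt_of_le one_pos (le_trans (le_of_eq ?_)
    (Finset.single_le_sum (fun d _ ↦ coeff_mulSeries_inertFactor_nonneg d) h0))
  rw [coeff_mulSeries, Finsupp.prod_zero_index]

/-- The generating function of the norm forms, as the square root with nonnegative constant term of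
`(1 - u)⁻¹ (1 - q u)⁻¹ ∏ (1 - u ^ (2 deg P))⁻¹`. -/
theorem mk_normCount_eq (hodd : Odd (Fintype.card F)) :
    (PowerSeries.mk fun n ↦ (normCount F n : ℝ)) =
      invSqrtSeries * inertSeries F * PowerSeries.rescale (Fintype.card F : ℝ) invSqrtSeries := by
  have hone {f g : MonicPrime F → PowerSeries ℝ} (hf : ∀ P, PowerSeries.constantCoeff (f P) = 1)
      (hg : ∀ P, PowerSeries.constantCoeff (g P) = 1) (P : MonicPrime F) :
      PowerSeries.constantCoeff ((f * g) P) = 1 := by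
    rw [Pi.mul_apply, map_mul, hf, hg, one_mul]
  have hn := constantCoeff_normFactor (F := F)
  have hr := constantCoeff_ramifiedFactor (F := F)
  have hc := constantCoeff_charFactor (F := F)
  have hi := constantCoeff_inertFactor (F := F)
  have hz : ∀ P : MonicPrime F, PowerSeries.constantCoeff (zetaFactor P) = 1 :=
    fun _ ↦ constantCoeff_geomSeries
  have h := congrArg (fun f ↦ degreeSeries (mulSeries f)) (normFactor_mul_self (F := F))
  rw [mulSeries_mul hn hn, mulSeries_mul hr (hone hz (hone hc (hone hi hi))),
    mulSeries_mul hz (hone hc (hone hi hi)), mulSeries_mul hc (hone hi hi),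
    mulSeries_mul hi hi] at h
  simp only [degreeSeries_mul] at h
  rw [degreeSeries_norm hodd, degreeSeries_ramified, degreeSeries_zeta, degreeSeries_char hodd,
    ← inertSeries] at h
  have hg : geomSeries = invSqrtSeries ^ 2 := invSqrtSeries_sq.symm
  have hsq : (PowerSeries.mk fun n ↦ (normCount F n : ℝ)) ^ 2 = (invSqrtSeries * inertSeries F *
      PowerSeries.rescale (Fintype.card F : ℝ) invSqrtSeries) ^ 2 := by
    rw [sq, h, hg, map_pow]; ring
  rcases sq_eq_sq_iff_eq_or_eq_neg.1 hsq with h' | h'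
  · exact h'
  -- The other sign would make the constant term negative.
  · exfalso
    have h0 := congrArg PowerSeries.constantCoeff h'
    have hres : PowerSeries.constantCoeff
        (PowerSeries.rescale (Fintype.card F : ℝ) invSqrtSeries) = 1 := by
      rw [← PowerSeries.coeff_zero_eq_constantCoeff_apply, PowerSeries.coeff_rescale]
      simp [constantCoeff_invSqrtSeries]
    have hpos := coeff_zero_inertSeries_pos (F := F)
    rw [PowerSeries.coeff_zero_eq_constantCoeff_apply] at hpos
    rw [map_neg, map_mul, map_mul, hres, constantCoeff_invSqrtSeries,
      ← PowerSeries.coeff_zero_eq_constantCoeff_apply, PowerSeries.coeff_mk] at h0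
    have : (0 : ℝ) ≤ normCount F 0 := Nat.cast_nonneg _
    linarith

theorem one_lt_sqrt_card : 1 < √(Fintype.card F : ℝ) := by
  rw [Real.lt_sqrt zero_le_one, one_pow]
  exact_mod_cast Fintype.one_lt_card (α := F)

theorem sqrt_card_div_card_lt_one : √(Fintype.card F : ℝ) / Fintype.card F < 1 := by
  rw [Real.sqrt_div_self]
  exact inv_lt_one_of_one_lt₀ one_lt_sqrt_card

theorem summable_coeff_inertSeries_div :
    Summable fun n ↦ PowerSeries.coeff n (inertSeries F) / (Fintype.card F : ℝ) ^ n := by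
  have hr0 : 0 ≤ √(Fintype.card F : ℝ) / Fintype.card F := by positivity
  refine (summable_geometric_of_lt_one hr0 (sqrt_card_div_card_lt_one (F := F))).of_nonneg_of_le
    (fun n ↦ div_nonneg (coeff_inertSeries_nonneg n) (by positivity)) fun n ↦ ?_
  rw [div_pow]
  exact div_le_div_of_nonneg_right (coeff_inertSeries_le n) (by positivity)

/-- The coefficients of `(1 - u) ^ (-1/2) ∏ (1 - u ^ (2 deg P)) ^ (-1/2)`, a function that is
analytic in `|u| < q ^ (-1/2)`. -/
noncomputable def analyticCoeff (F : Type*) [Field F] [Fintype F] (n : ℕ) : ℝ :=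
  PowerSeries.coeff n (invSqrtSeries * inertSeries F)

theorem analyticCoeff_nonneg (n : ℕ) : 0 ≤ analyticCoeff F n := by
  rw [analyticCoeff, PowerSeries.coeff_mul]
  refine Finset.sum_nonneg fun p _ ↦ mul_nonneg ?_ (coeff_inertSeries_nonneg _)
  simpa [invSqrtSeries] using invSqrtCoeff_nonneg _

theorem analyticCoeff_le (n : ℕ) :
    analyticCoeff F n ≤ (n + 1) * √(Fintype.card F : ℝ) ^ n := by
  rw [analyticCoeff, PowerSeries.coeff_mul]
  calc ∑ p ∈ antidiagonal n,
        PowerSeries.coeff p.1 invSqrtSeries * PowerSeries.coeff p.2 (inertSeries F)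
      ≤ ∑ _p ∈ antidiagonal n, √(Fintype.card F : ℝ) ^ n := by
        refine Finset.sum_le_sum fun p hp ↦ ?_
        have h1 : PowerSeries.coeff p.1 invSqrtSeries ≤ 1 := by
          simpa [invSqrtSeries] using invSqrtCoeff_le_one _
        refine (mul_le_of_le_one_left (coeff_inertSeries_nonneg _) h1).trans
          ((coeff_inertSeries_le _).trans ?_)
        exact pow_le_pow_right₀ one_lt_sqrt_card.le
          (by rw [← mem_antidiagonal.1 hp]; exact Nat.le_add_left _ _)
    _ = _ := by simp

theorem summable_succ_pow_mul_geometric (m : ℕ) {r : ℝ} (hr0 : 0 < r) (hr1 : r < 1) :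
    Summable fun n : ℕ ↦ ((n : ℝ) + 1) ^ m * r ^ n := by
  have h := (summable_nat_add_iff 1).2 (summable_pow_mul_geometric_of_norm_lt_one m
    (r := r) (by rwa [Real.norm_of_nonneg hr0.le]))
  refine (h.mul_left r⁻¹).congr fun n ↦ ?_
  push_cast
  rw [pow_succ]
  field_simp

theorem summable_analyticCoeff_div_mul_sq :
    Summable fun n : ℕ ↦ analyticCoeff F n / (Fintype.card F : ℝ) ^ n * ((n : ℝ) + 1) ^ 2 := by
  have hq : (0 : ℝ) < Fintype.card F := by exact_mod_cast Fintype.card_pos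
  have hr0 : 0 < √(Fintype.card F : ℝ) / Fintype.card F := by positivity
  have hs := summable_succ_pow_mul_geometric 3 hr0 (sqrt_card_div_card_lt_one (F := F))
  refine hs.of_nonneg_of_le (fun n ↦ ?_) fun n ↦ ?_
  · have := analyticCoeff_nonneg (F := F) n
    positivity
  · calc analyticCoeff F n / (Fintype.card F : ℝ) ^ n * ((n : ℝ) + 1) ^ 2
        ≤ (n + 1) * √(Fintype.card F : ℝ) ^ n / (Fintype.card F : ℝ) ^ n * ((n : ℝ) + 1) ^ 2 :=
          mul_le_mul_of_nonneg_right
            (div_le_div_of_nonneg_right (analyticCoeff_le n) (pow_nonneg hq.le n)) (sq_nonneg _)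
      _ = _ := by rw [div_pow]; ring

theorem summable_analyticCoeff_div :
    Summable fun n : ℕ ↦ analyticCoeff F n / (Fintype.card F : ℝ) ^ n := by
  refine (summable_analyticCoeff_div_mul_sq (F := F)).of_nonneg_of_le
    (fun n ↦ div_nonneg (analyticCoeff_nonneg n) (by positivity)) fun n ↦ ?_
  refine le_mul_of_one_le_right (div_nonneg (analyticCoeff_nonneg n) (by positivity)) ?_
  exact one_le_pow₀ (by linarith [(Nat.cast_nonneg n : (0 : ℝ) ≤ n)])

theorem inv_card_lt_one : (Fintype.card F : ℝ)⁻¹ < 1 :=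
  inv_lt_one_of_one_lt₀ (by exact_mod_cast Fintype.one_lt_card (α := F))

theorem tsum_analyticCoeff_div :
    ∑' n, analyticCoeff F n / (Fintype.card F : ℝ) ^ n =
      (1 - (Fintype.card F : ℝ)⁻¹) ^ (-(1 / 2) : ℝ) *
        ∑' n, PowerSeries.coeff n (inertSeries F) / (Fintype.card F : ℝ) ^ n := by
  have h0 : 0 ≤ (Fintype.card F : ℝ)⁻¹ := by positivity
  rw [← tsum_invSqrtCoeff_mul_pow h0 inv_card_lt_one,
    tsum_mul_tsum_eq_tsum_sum_antidiagonal_of_summable_norm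
      (summable_invSqrtCoeff_mul_pow h0 inv_card_lt_one).norm
      (summable_coeff_inertSeries_div (F := F)).norm]
  refine tsum_congr fun n ↦ ?_
  rw [analyticCoeff, PowerSeries.coeff_mul, Finset.sum_div]
  refine Finset.sum_congr rfl fun p hp ↦ ?_
  rw [← mem_antidiagonal.1 hp, pow_add, invSqrtSeries, PowerSeries.coeff_mk, inv_pow]
  field_simp

theorem normCount_div_eq_tsum (hodd : Odd (Fintype.card F)) (n : ℕ) :
    (normCount F n : ℝ) / (Fintype.card F : ℝ) ^ n =
      ∑' k, analyticCoeff F k / (Fintype.card F : ℝ) ^ k *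
        (if k ≤ n then invSqrtCoeff (n - k) else 0) := by
  have h := congrArg (PowerSeries.coeff n) (mk_normCount_eq hodd)
  rw [PowerSeries.coeff_mk, PowerSeries.coeff_mul, Finset.Nat.sum_antidiagonal_eq_sum_range_succ_mk]
    at h
  rw [h, Finset.sum_div, tsum_eq_sum (s := Finset.range n.succ)]
  · refine Finset.sum_congr rfl fun k hk ↦ ?_
    have hkn : k ≤ n := Nat.lt_succ_iff.1 (Finset.mem_range.1 hk)
    have hq : (0 : ℝ) < Fintype.card F := by exact_mod_cast Fintype.card_pos
    rw [if_pos hkn, PowerSeries.coeff_rescale, invSqrtSeries, PowerSeries.coeff_mk,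
      ← invSqrtSeries, ← analyticCoeff, ← Nat.add_sub_of_le hkn, Nat.add_sub_cancel_left, pow_add]
    field_simp
  · intro k hk
    rw [Finset.mem_range, Nat.lt_succ_iff] at hk
    rw [if_neg hk, mul_zero]

end InertSeries

/-! ### The Euler product for the leading constant -/

section LandauConstant

variable {F : Type*} [Field F] [Fintype F]

/-- The terms at `u = 1 / q` of the local factor of `inertSeries` at `P`. -/
noncomputable def inertTerm (P : MonicPrime F) (k : ℕ) : ℝ :=
  PowerSeries.coeff k (inertFactor P) * ((Fintype.card F : ℝ)⁻¹ ^ primeDegree P) ^ k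

theorem inertTerm_nonneg (P : MonicPrime F) (k : ℕ) : 0 ≤ inertTerm P k :=
  mul_nonneg (coeff_inertFactor_nonneg P k) (by positivity)

theorem inv_card_pow_primeDegree_lt_one (P : MonicPrime F) :
    (Fintype.card F : ℝ)⁻¹ ^ primeDegree P < 1 :=
  pow_lt_one₀ (by positivity) inv_card_lt_one P.2.2.natDegree_pos.ne'

theorem summable_inertTerm (P : MonicPrime F) : Summable (inertTerm P) := by
  refine (summable_geometric_of_lt_one (by positivity)
    (inv_card_pow_primeDegree_lt_one P)).of_nonneg_of_le (inertTerm_nonneg P) fun k ↦ ?_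
  exact mul_le_of_le_one_left (by positivity) (coeff_inertFactor_le_one P k)

theorem tsum_inertTerm_of_inert {P : MonicPrime F} (hP : constCoeffChar P.1 = -1) :
    ∑' k, inertTerm P k = (1 - ((absValue P.1 : ℝ) ^ 2)⁻¹) ^ (-(1 / 2) : ℝ) := by
  set x : ℝ := (Fintype.card F : ℝ)⁻¹ ^ primeDegree P with hx
  have hx0 : 0 ≤ x := by positivity
  have hx1 : x < 1 := inv_card_pow_primeDegree_lt_one P
  have habs : ((absValue P.1 : ℝ) ^ 2)⁻¹ = x ^ 2 := by
    rw [hx, absValue, primeDegree]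
    push_cast
    rw [inv_pow, inv_pow]
  have hfac : inertFactor P = expandTwo invSqrtSeries := if_pos hP
  rw [habs, ← tsum_invSqrtCoeff_mul_pow (sq_nonneg x) (pow_lt_one₀ hx0 hx1 two_ne_zero)]
  have hinj : Function.Injective fun k : ℕ ↦ 2 * k := fun a b h ↦ by
    simpa using h
  rw [← hinj.tsum_eq (f := inertTerm P)]
  · refine tsum_congr fun k ↦ ?_
    rw [inertTerm, hfac, coeff_expandTwo, if_pos (dvd_mul_right 2 k),
      Nat.mul_div_cancel_left k two_pos, invSqrtSeries, PowerSeries.coeff_mk, pow_mul]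
  · intro k hk
    by_contra hodd
    refine hk ?_
    have : ¬2 ∣ k := fun ⟨m, hm⟩ ↦ hodd ⟨m, hm.symm⟩
    rw [inertTerm, coeff_inertFactor_of_odd P this, zero_mul]

theorem tsum_inertTerm_of_not_inert {P : MonicPrime F} (hP : constCoeffChar P.1 ≠ -1) :
    ∑' k, inertTerm P k = 1 := by
  have hfac : inertFactor P = 1 := if_neg hP
  rw [tsum_eq_single 0]
  · simp [inertTerm, hfac]
  · intro k hk
    rw [inertTerm, hfac, PowerSeries.coeff_one, if_neg hk, zero_mul]

theorem prod_inertTerm (d : MonicPrime F →₀ ℕ) :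
    d.prod inertTerm = MvPowerSeries.coeff d (mulSeries inertFactor) /
      (Fintype.card F : ℝ) ^ Finsupp.weight primeDegree d := by
  unfold inertTerm
  rw [Finsupp.prod_mul, coeff_mulSeries, div_eq_mul_inv, ← inv_pow, Finsupp.weight_apply]
  congr 1
  rw [Finsupp.prod, Finsupp.sum, ← Finset.prod_pow_eq_pow_sum]
  refine Finset.prod_congr rfl fun P _ ↦ ?_
  rw [← pow_mul, smul_eq_mul, mul_comm]

/-- Sorting the factorizations by degree. -/
theorem hasSum_prod_inertTerm : HasSum (fun d : MonicPrime F →₀ ℕ ↦ d.prod inertTerm)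
    (∑' n, PowerSeries.coeff n (inertSeries F) / (Fintype.card F : ℝ) ^ n) := by
  let w : (MonicPrime F →₀ ℕ) → ℕ := fun d ↦ Finsupp.weight primeDegree d
  rw [← (Equiv.sigmaFiberEquiv w).hasSum_iff]
  have hfib (n : ℕ) : HasSum (fun d : {d // w d = n} ↦ d.1.prod inertTerm)
      (PowerSeries.coeff n (inertSeries F) / (Fintype.card F : ℝ) ^ n) := by
    have hfin : {d : MonicPrime F →₀ ℕ | w d = n}.Finite := finite_weight_primeDegree_eq n
    have : Fintype {d // w d = n} := hfin.fintype
    have h := hasSum_fintype (fun d : {d // w d = n} ↦ d.1.prod inertTerm)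
    convert h using 1
    rw [coeff_inertSeries, Finset.sum_div]
    have hmem (d : MonicPrime F →₀ ℕ) :
        d ∈ (finite_weight_primeDegree_eq n).toFinset ↔ w d = n := Set.Finite.mem_toFinset _
    refine Finset.sum_bij' (fun d hd ↦ ⟨d, (hmem d).1 hd⟩) (fun d _ ↦ d.1)
      (fun _ _ ↦ Finset.mem_univ _) (fun d _ ↦ (hmem d.1).2 d.2)
      (fun _ _ ↦ rfl) (fun _ _ ↦ rfl) fun d hd ↦ ?_
    have hd' : Finsupp.weight primeDegree d = n := (hmem d).1 hd
    rw [prod_inertTerm, hd']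
  have hsum : Summable ((fun d : MonicPrime F →₀ ℕ ↦ d.prod inertTerm) ∘
      Equiv.sigmaFiberEquiv w) := by
    refine (summable_sigma_of_nonneg fun x ↦ ?_).2 ⟨fun n ↦ (hfib n).summable, ?_⟩
    · exact Finset.prod_nonneg fun P _ ↦ inertTerm_nonneg P _
    · refine (summable_coeff_inertSeries_div (F := F)).congr fun n ↦ ?_
      exact (hfib n).tsum_eq.symm
  have h2 := hsum.hasSum.sigma hfib
  rw [h2.tsum_eq]
  exact hsum.hasSum

/-- The Euler product at `u = 1 / q`. -/
theorem hasProd_eulerFactor (hodd : Odd (Fintype.card F)) :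
    HasProd (fun P : InertPrime F ↦ eulerFactor P)
      (∑' n, PowerSeries.coeff n (inertSeries F) / (Fintype.card F : ℝ) ^ n) := by
  have h1 : ∀ P : MonicPrime F, inertTerm P 0 = 1 := fun P ↦ by
    simp [inertTerm, constantCoeff_inertFactor]
  have h := hasProd_tsum_of_summable_prod h1 inertTerm_nonneg summable_inertTerm
    hasSum_prod_inertTerm.summable
  rw [hasSum_prod_inertTerm.tsum_eq] at h
  let ι : InertPrime F → MonicPrime F := fun P ↦ ⟨P.1, P.2.1, P.2.2.1⟩
  have hι : Function.Injective ι := fun P Q h ↦ Subtype.ext (congrArg (fun R ↦ R.1) h)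
  have hout : ∀ P ∉ Set.range ι, ∑' k, inertTerm P k = 1 := fun P hP ↦
    tsum_inertTerm_of_not_inert fun hchar ↦
      hP ⟨⟨P.1, P.2.1, P.2.2, (legendre_X_eq_neg_one_iff hodd P.1).2 hchar⟩, rfl⟩
  refine ((hι.hasProd_iff hout).2 h).congr_fun fun P ↦ ?_
  exact (tsum_inertTerm_of_inert (P := ι P) ((legendre_X_eq_neg_one_iff hodd P.1).1 P.2.2.2)).symm

theorem tsum_analyticCoeff_div_eq_landauConst (hodd : Odd (Fintype.card F)) :
    ∑' n, analyticCoeff F n / (Fintype.card F : ℝ) ^ n = landauConst F := by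
  rw [tsum_analyticCoeff_div, landauConst, (hasProd_eulerFactor hodd).tprod_eq]

end LandauConstant

end FunctionFieldLandau

/-! ### The asymptotic formula -/

open FunctionFieldLandau in
theorem theorem1p3 (F : Type*) [Field F] [Fintype F] (hodd : Odd (Fintype.card F)) :
    Multipliable (fun P : FunctionFieldLandau.InertPrime F => FunctionFieldLandau.eulerFactor P) ∧
    (fun n : ℕ => (FunctionFieldLandau.normCount F n : ℝ) -
        FunctionFieldLandau.landauConst F / Real.sqrt Real.pi *
          ((Fintype.card F : ℝ) ^ n / Real.sqrt n))
      =O[atTop] (fun n : ℕ => (Fintype.card F : ℝ) ^ n / (n : ℝ) ^ (3 / 2 : ℝ)) := by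
  refine ⟨(hasProd_eulerFactor hodd).multipliable, ?_⟩
  set q : ℝ := (Fintype.card F : ℝ) with hqdef
  have hq : 0 < q := by rw [hqdef]; exact_mod_cast Fintype.card_pos
  let α : ℕ → ℝ := fun k ↦ analyticCoeff F k / q ^ k
  have hα0 (k : ℕ) : 0 ≤ α k := div_nonneg (analyticCoeff_nonneg k) (pow_nonneg hq.le k)
  have hα : Summable α := summable_analyticCoeff_div
  have hα2 : Summable fun k : ℕ ↦ α k * ((k : ℝ) + 1) ^ 2 := summable_analyticCoeff_div_mul_sq
  let M : ℝ := 4 / √Real.pi * ∑' k : ℕ, α k * ((k : ℝ) + 1) ^ 2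
  refine IsBigO.of_bound M ?_
  filter_upwards [eventually_gt_atTop 0] with n hn
  have hn' : (0 : ℝ) < n := by exact_mod_cast hn
  let x : ℕ → ℝ := fun k ↦ if k ≤ n then invSqrtCoeff (n - k) else 0
  have hx (k : ℕ) : |x k - 1 / √(Real.pi * n)|
      ≤ 4 / √Real.pi * ((k + 1) ^ 2 / (n : ℝ) ^ (3 / 2 : ℝ)) := abs_invSqrtCoeff_sub_le n k hn
  have hxs : Summable fun k ↦ α k * x k :=
    summable_of_ne_finset_zero (s := Finset.range (n + 1)) fun k hk ↦ by
      rw [Finset.mem_range, Nat.lt_succ_iff] at hk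
      simp only [x, if_neg hk, mul_zero]
  have hB : (normCount F n : ℝ) / q ^ n = ∑' k, α k * x k := normCount_div_eq_tsum hodd n
  have hK : landauConst F = ∑' k, α k := (tsum_analyticCoeff_div_eq_landauConst hodd).symm
  have hdiff : (normCount F n : ℝ) / q ^ n - landauConst F * (1 / √(Real.pi * n))
      = ∑' k, α k * (x k - 1 / √(Real.pi * n)) := by
    rw [hB, hK, ← tsum_mul_right, ← hxs.tsum_sub (hα.mul_right _)]
    exact tsum_congr fun k ↦ by ring
  have hbound : Summable fun k : ℕ ↦
      4 / √Real.pi / (n : ℝ) ^ (3 / 2 : ℝ) * (α k * ((k : ℝ) + 1) ^ 2) := hα2.mul_left _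
  have hle : |(normCount F n : ℝ) / q ^ n - landauConst F * (1 / √(Real.pi * n))|
      ≤ M / (n : ℝ) ^ (3 / 2 : ℝ) := by
    rw [hdiff, ← Real.norm_eq_abs]
    refine (tsum_of_norm_bounded hbound.hasSum fun k ↦ ?_).trans (le_of_eq ?_)
    · rw [norm_mul, Real.norm_of_nonneg (hα0 k), Real.norm_eq_abs]
      refine (mul_le_mul_of_nonneg_left (hx k) (hα0 k)).trans (le_of_eq ?_)
      ring
    · rw [tsum_mul_left]
      simp only [M]
      ring
  have e : (normCount F n : ℝ) - landauConst F / √Real.pi * (q ^ n / √n)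
      = ((normCount F n : ℝ) / q ^ n - landauConst F * (1 / √(Real.pi * n))) * q ^ n := by
    rw [Real.sqrt_mul Real.pi_pos.le]
    field_simp
  rw [e, norm_mul, Real.norm_of_nonneg (pow_nonneg hq.le n), Real.norm_eq_abs,
    Real.norm_of_nonneg (by positivity)]
  calc _ ≤ M / (n : ℝ) ^ (3 / 2 : ℝ) * q ^ n := mul_le_mul_of_nonneg_right hle (by positivity)
    _ = _ := by ring
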